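/- **Conventions.** For a topological space $Y$, let $C_c(Y)$ be the linear span, in the space of all functions $Y\to\mathbb{C}$, of the functions $f$ for which there is a Hausdorff open set $U\subseteq Y$ such that $f$ vanishes outside $U$ and $f|_U$ is continuous with compact support. A *locally compact groupoid* is a topological groupoid $G$ (a groupoid whose set of arrows carries a topology for which multiplication on composable pairs and inversion are continuous), possibly non-Hausdorff, with domain and range maps $d,r$ and fibres $G^u=r^{-1}(u)$, $G_u=d^{-1}(u)$, such that: the unit space $G^0$ is locally compact Hausdorff; there is a countable family of compact Hausdorff subsets of $G$ whose interiors form a basis of the topology of $G$; and every $G^u$ ($u\in G^0$) is locally compact Hausdorff. A *left Haar system* on $G$ is a family $\lambda=\{\lambda^u\}_{u\in G^0}$ of regular Borel measures $\lambda^u$ on $G^u$ with full support such that $u\mapsto\int_{G^u} g\,d\lambda^u$ lies in $C_c(G^0)$ for all $g\in C_c(G)$, and $\int_{G^{d(x)}} f(xz)\,d\lambda^{d(x)}(z)=\int_{G^{r(x)}} f(y)\,d\lambda^{r(x)}(y)$ for all $x\in G$ and $f\in C_c(G)$. Put $\lambda_v(E)=\lambda^v(E^{-1})$ for $E \subseteq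 G_v$ Borel. For $f\in C_c(G)$ and $v\in G^0$ let $\operatorname{Ind}v(f)$ be the operator on $L^2(G_v,\lambda_v)$ given by $(\operatorname{Ind}v(f)\xi)(x)=\int_{G_v} f(xt^{-1})\xi(t)\,d\lambda_v(t)$. The reduced $C^*$-algebra $C^*_r(G,\lambda)$ is the norm closure of the $*$-algebra of operators $\bigoplus_{v}\operatorname{Ind}v(f)$, $f\in C_c(G)$, on $\bigoplus_{v\in G^0}L^2(G_v,\lambda_v)$; we write $[f]_G$ for the element $\bigoplus_v\operatorname{Ind}v(f)$. **Theorem.** Let $G$ be a locally compact groupoid with a left Haar system $\lambda$. Let $H$ be a clopen subset of $G$ that is a subgroupoid (closed under multiplication and inversion), with the subspace topology, and let $\lambda_H$ be the restriction of $\lambda$ to $H$, that is, $\lambda_H^u=\lambda^u|_{H^u}$ for $u\in H^0=H\cap G^0$. Then there is an injective $*$-homomorphism $\iota\colon C^*_r(H,\lambda_H)\to C^*_r(G,\lambda)$ with $\iota([f]_H)=[\tilde f]_G$ for all $f\in C_c(H)$, where $\tilde f\in C_c(G)$ is the extension of $f$ by zero, and this inclusion admits a conditional expectation: there is a contractive,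 completely positive linear map $e\colon C^*_r(G,\lambda)\to C^*_r(H,\lambda_H)$ such that \[ e(\iota(a)\,b\,\iota(c))=a\,e(b)\,c,\qquad e(\iota(a))=a \] for all $a,c\in C^*_r(H,\lambda_H)$ and $b\in C^*_r(G,\lambda)$. Moreover, for every $f\in C_c(G)$ the restriction $f|_H$ lies in $C_c(H)$ and $e([f]_G)=[f|_H]_H$. -/

import Mathlib

open CategoryTheory MeasureTheory Topology
open scoped CStarAlgebra ENNReal

universe u v

noncomputable section

/-! ### Compactly supported functions on locally Hausdorff spaces -/

/-- The complex functions on `Y` that vanish off some Hausdorff open set `U` and are continuous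
with compact support on `U`. -/
def CcZero (Y : Type*) [TopologicalSpace Y] : Set (Y → ℂ) :=
  {f | ∃ U : Set Y, IsOpen U ∧ T2Space U ∧ (∀ y, y ∉ U → f y = 0) ∧
    Continuous (U.domRestrict f) ∧ HasCompactSupport (U.domRestrict f)}

/-- `C_c(Y)`: the linear span of `CcZero Y` among all complex functions on `Y`. -/
def Cc (Y : Type*) [TopologicalSpace Y] : Submodule ℂ (Y → ℂ) :=
  Submodule.span ℂ (CcZero Y)

/-! ### Topological groupoids

A groupoid is given as a Mathlib groupoid on its set `C` of objects.  The set of all arrows is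
`Arrows C`; this is what is called `G` in the comments, and it is the set of arrows that carries
the topology.  The product `x · y`, defined when `d(x) = r(y)`, is the composite `y ≫ x`. -/

/-- The set `G` of all arrows `hom` of a groupoid, with `d(hom) = dom` and `r(hom) = cod`. -/
structure Arrows (C : Type u) [Groupoid.{v} C] where
  {dom cod : C}
  hom : dom ⟶ cod

/-- The unit space `G⁰`: objects, identified with their identity arrows. -/
structure UnitSpace (C : Type u) [Groupoid.{v} C] where
  obj : C

/-- `G⁰` has the subspace topology from `G`. -/
instance UnitSpace.instTopologicalSpace (C : Type u) [Groupoid.{v} C]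
    [TopologicalSpace (Arrows C)] : TopologicalSpace (UnitSpace C) :=
  TopologicalSpace.induced (fun w => Arrows.mk (𝟙 w.obj)) inferInstance

/-- The set `G²` of composable pairs `(x, y)`, `d(x) = r(y)`: here `y : a ⟶ b` and `x : b ⟶ c`. -/
structure ComposablePair (C : Type u) [Groupoid.{v} C] where
  {a b c : C}
  x : b ⟶ c
  y : a ⟶ b

/-- `G²` has the subspace topology from `G × G`. -/
instance ComposablePair.instTopologicalSpace (C : Type u) [Groupoid.{v} C]
    [TopologicalSpace (Arrows C)] : TopologicalSpace (ComposablePair C) :=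
  TopologicalSpace.induced (fun p => (Arrows.mk p.x, Arrows.mk p.y)) inferInstance

/-- The fibre `Gᵘ = r⁻¹(u)`, here at `u = w`. -/
structure RangeFiber {C : Type u} [Groupoid.{v} C] (w : C) where
  {dom : C}
  hom : dom ⟶ w

/-- The fibre `Gᵤ = d⁻¹(u)`, here at `u = w`. -/
structure SourceFiber {C : Type u} [Groupoid.{v} C] (w : C) where
  {cod : C}
  hom : w ⟶ cod

section Fibers

variable {C : Type u} [Groupoid.{v} C]

/-- The inclusion of `Gᵘ` in `G`. -/
def RangeFiber.toArrow {w : C} (y : RangeFiber w) : Arrows C :=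
  Arrows.mk y.hom

/-- The inclusion of `Gᵤ` in `G`. -/
def SourceFiber.toArrow {w : C} (y : SourceFiber w) : Arrows C :=
  Arrows.mk y.hom

instance RangeFiber.instTopologicalSpace [TopologicalSpace (Arrows C)] (w : C) :
    TopologicalSpace (RangeFiber w) :=
  TopologicalSpace.induced RangeFiber.toArrow inferInstance

instance RangeFiber.instMeasurableSpace [TopologicalSpace (Arrows C)] (w : C) :
    MeasurableSpace (RangeFiber w) := borel _

instance RangeFiber.instBorelSpace [TopologicalSpace (Arrows C)] (w : C) :
    BorelSpace (RangeFiber w) := ⟨rfl⟩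

instance SourceFiber.instTopologicalSpace [TopologicalSpace (Arrows C)] (w : C) :
    TopologicalSpace (SourceFiber w) :=
  TopologicalSpace.induced SourceFiber.toArrow inferInstance

instance SourceFiber.instMeasurableSpace [TopologicalSpace (Arrows C)] (w : C) :
    MeasurableSpace (SourceFiber w) := borel _

instance SourceFiber.instBorelSpace [TopologicalSpace (Arrows C)] (w : C) :
    BorelSpace (SourceFiber w) := ⟨rfl⟩

end Fibers

/-- Topological groupoids: multiplication and inversion are continuous. -/
class IsTopologicalGroupoid (C : Type u) [Groupoid.{v} C] [TopologicalSpace (Arrows C)] :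
    Prop where
  continuous_mul : Continuous fun p : ComposablePair C => Arrows.mk (p.y ≫ p.x)
  continuous_inv : Continuous fun x : Arrows C => Arrows.mk (Groupoid.inv x.hom)

/-- The topological axioms of a locally compact, locally Hausdorff groupoid.  The Haar system is
kept as a separate datum, see `IsHaarSystem`. -/
class IsLocallyCompactGroupoid (C : Type u) [Groupoid.{v} C] [TopologicalSpace (Arrows C)] :
    Prop extends IsTopologicalGroupoid C where
  unit_locallyCompact : LocallyCompactSpace (UnitSpace C)
  unit_t2 : T2Space (UnitSpace C)
  exists_countable_basis : ∃ K : Set (Set (Arrows C)), K.Countable ∧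
    (∀ s ∈ K, IsCompact s ∧ T2Space s) ∧
    TopologicalSpace.IsTopologicalBasis (interior '' K)
  fiber_locallyCompact : ∀ w : C, LocallyCompactSpace (RangeFiber w)
  fiber_t2 : ∀ w : C, T2Space (RangeFiber w)

/-- Left Haar systems.  Regularity in the sense of `Measure.Regular` includes finiteness on
compact sets. -/
structure IsHaarSystem {C : Type u} [Groupoid.{v} C] [TopologicalSpace (Arrows C)]
    (lam : ∀ w : C, Measure (RangeFiber w)) : Prop where
  regular : ∀ w, (lam w).Regular
  full_support : ∀ w, (lam w).IsOpenPosMeasure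
  continuous_integral : ∀ g ∈ Cc (Arrows C),
    (fun w : UnitSpace C => ∫ y : RangeFiber w.obj, g y.toArrow ∂(lam w.obj)) ∈ Cc (UnitSpace C)
  left_invariant : ∀ {a b : C} (x : a ⟶ b), ∀ f ∈ Cc (Arrows C),
    ∫ z : RangeFiber a, f (Arrows.mk (z.hom ≫ x)) ∂(lam a) =
      ∫ y : RangeFiber b, f y.toArrow ∂(lam b)

/-! ### The reduced groupoid C⋆-algebra -/

section Reduced

variable {C : Type u} [Groupoid.{v} C] [TopologicalSpace (Arrows C)]

/-- The right Haar system: `λᵥ(E) = λᵛ(E⁻¹)`, the image of `λᵛ` under inversion. -/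
def rightMeasure (lam : ∀ w : C, Measure (RangeFiber w)) (w : C) : Measure (SourceFiber w) :=
  Measure.map (fun y : RangeFiber w => SourceFiber.mk (Groupoid.inv y.hom)) (lam w)

/-- The Hilbert space `⨁ᵥ L²(Gᵥ, λᵥ)`, the sum being over all units. -/
abbrev RegularRepSpace (lam : ∀ w : C, Measure (RangeFiber w)) : Type (max u v) :=
  lp (fun w : C => Lp ℂ 2 (rightMeasure lam w)) 2

/-- `IsRegularOperator lam f T` says that the bounded operator `T` on `⨁ᵥ L²(Gᵥ, λᵥ)` is
`⨁ᵥ Ind v (f)`, that is, `(T ξ)ᵥ(x) = ∫ f(x t⁻¹) ξᵥ(t) dλᵥ(t)` for all `ξ`, `v` and almost every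
`x ∈ Gᵥ`.  There is at most one such `T`. -/
def IsRegularOperator (lam : ∀ w : C, Measure (RangeFiber w)) (f : Arrows C → ℂ)
    (T : RegularRepSpace lam →L[ℂ] RegularRepSpace lam) : Prop :=
  ∀ (ξ : RegularRepSpace lam) (w : C), ∀ᵐ x ∂(rightMeasure lam w),
    (T ξ w : SourceFiber w → ℂ) x =
      ∫ t : SourceFiber w, f (Arrows.mk (Groupoid.inv t.hom ≫ x.hom)) *
        (ξ w : SourceFiber w → ℂ) t ∂(rightMeasure lam w)

/-- The closed `⋆`-algebra of operators on `⨁ᵥ L²(Gᵥ, λᵥ)` generated by the image of `C_c(G)`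
under `⨁ᵥ Ind v`.  For a Haar system this image is itself a `⋆`-algebra (`⨁ᵥ Ind v` is a
`⋆`-representation of the convolution algebra), so this is the norm closure of the image. -/
def reducedSubalgebra (lam : ∀ w : C, Measure (RangeFiber w)) :
    NonUnitalStarSubalgebra ℂ (RegularRepSpace lam →L[ℂ] RegularRepSpace lam) :=
  (NonUnitalStarAlgebra.adjoin ℂ
    {T | ∃ f ∈ Cc (Arrows C), IsRegularOperator lam f T}).topologicalClosure

/-- The reduced groupoid C⋆-algebra `C⋆ᵣ(G, λ)`. -/
def ReducedCStarAlgebra (lam : ∀ w : C, Measure (RangeFiber w)) : Type (max u v) :=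
  reducedSubalgebra lam

instance ReducedCStarAlgebra.instNonUnitalCStarAlgebra (lam : ∀ w : C, Measure (RangeFiber w)) :
    NonUnitalCStarAlgebra (ReducedCStarAlgebra lam) :=
  NonUnitalStarSubalgebra.nonUnitalCStarAlgebra (reducedSubalgebra lam)
    (h_closed := NonUnitalStarSubalgebra.isClosed_topologicalClosure _)

/-- The usual order of a C⋆-algebra. -/
instance ReducedCStarAlgebra.instPartialOrder (lam : ∀ w : C, Measure (RangeFiber w)) :
    PartialOrder (ReducedCStarAlgebra lam) := CStarAlgebra.spectralOrder _

instance ReducedCStarAlgebra.instStarOrderedRing (lam : ∀ w : C, Measure (RangeFiber w)) :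
    StarOrderedRing (ReducedCStarAlgebra lam) := CStarAlgebra.spectralOrderedRing _

/-- An element of `C⋆ᵣ(G, λ)` as an operator on `⨁ᵥ L²(Gᵥ, λᵥ)`. -/
def ReducedCStarAlgebra.toOperator {lam : ∀ w : C, Measure (RangeFiber w)}
    (a : ReducedCStarAlgebra lam) : RegularRepSpace lam →L[ℂ] RegularRepSpace lam :=
  Subtype.val a

/-- `IsImage f a`: the element `a` of `C⋆ᵣ(G, λ)` is the image of the function `f`. -/
def ReducedCStarAlgebra.IsImage {lam : ∀ w : C, Measure (RangeFiber w)} (f : Arrows C → ℂ)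
    (a : ReducedCStarAlgebra lam) : Prop :=
  IsRegularOperator lam f a.toOperator

end Reduced

/-! ### Subgroupoids -/

section Subgroupoids

variable {C : Type u} [Groupoid.{v} C]

/-- The set of arrows of a subgroupoid `H`, as a subset of `G`. -/
def arrowSet (H : Subgroupoid C) : Set (Arrows C) := {x | x.hom ∈ H.arrows x.dom x.cod}

/-- The inclusion of `H` in `G`. -/
def inclArrows (H : Subgroupoid C) (x : Arrows H.objs) : Arrows C :=
  Arrows.mk (H.hom.map x.hom)

/-- `H` has the subspace topology from `G`. -/
instance instTopologicalSpaceArrowsObjs [TopologicalSpace (Arrows C)] (H : Subgroupoid C) :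
    TopologicalSpace (Arrows H.objs) :=
  TopologicalSpace.induced (inclArrows H) inferInstance

/-- The inclusion of `Hᵘ` in `Gᵘ`, for a unit `u` of `H`. -/
def inclFiber (H : Subgroupoid C) (w : H.objs) (y : RangeFiber w) : RangeFiber (w : C) :=
  RangeFiber.mk (H.hom.map y.hom)

/-- The restriction to `H` of a system of measures: `λ_Hᵘ(E) = λᵘ(E)` for Borel `E ⊆ Hᵘ`. -/
def restrictHaar [TopologicalSpace (Arrows C)] (H : Subgroupoid C)
    (lam : ∀ w : C, Measure (RangeFiber w)) (w : H.objs) : Measure (RangeFiber w) :=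
  Measure.comap (inclFiber H w) (lam w)

/-- Extension by zero of a function from `H` to `G`. -/
def extendByZero (H : Subgroupoid C) (f : Arrows H.objs → ℂ) : Arrows C → ℂ :=
  Function.extend (inclArrows H) f 0

/-- Restriction of a function from `G` to `H`. -/
def restrictFun (H : Subgroupoid C) (f : Arrows C → ℂ) : Arrows H.objs → ℂ :=
  fun x => f (inclArrows H x)

end Subgroupoids

/-! ### Conditional expectations -/

/-- Conditional expectations for an inclusion `ι : B → A` of C⋆-algebras: contractive completely
positive maps `e : A → B` with `e (a b c) = a e(b) c` and `e(a) = a` for `a, c ∈ B`, `b ∈ A`. -/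
structure IsConditionalExpectation {A B : Type*} [NonUnitalCStarAlgebra A]
    [NonUnitalCStarAlgebra B] [PartialOrder A] [PartialOrder B] [StarOrderedRing A]
    [StarOrderedRing B] (ι : B →⋆ₙₐ[ℂ] A) (e : A →CP B) : Prop where
  contractive : ∀ b : A, ‖e b‖ ≤ ‖b‖
  bimodule : ∀ (a c : B) (b : A), e (ι a * b * ι c) = a * e b * c
  apply_incl : ∀ a : B, e (ι a) = a

end

open CategoryTheory MeasureTheory Topology
open scoped CStarAlgebra ENNReal

noncomputable section

/-! Let R be restriction of functions from ⨁ᵥ L²(Gᵥ) to ⨁_w L²(H_w). Its adjoint is extension by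
zero, so R R⋆ = 1 (`adjoint_restrictRep_spec`). The compression T ↦ R T R⋆ is contractive and
completely positive (`cstarMatrix_map_nonneg_of_compression`), and on kernels it only cuts f(x t⁻¹)
down to x, t ∈ H. It therefore carries [f]_G to [f|_H]_H (`IsRegularOperator.compression`) and, by
continuity, C⋆ᵣ(G) into C⋆ᵣ(H). This is the expectation.

For the inclusion, let f vanish off H. Then f(x t⁻¹) ≠ 0 forces x and t to lie in the same right
coset of H. The fibre Gᵥ is the disjoint union of the cosets Hγ, with r(γ) a unit of H, and of the
arrows whose range is not a unit of H. On L²(Hγ) the operator is a copy of its compression on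
L²(H_{r(γ)}), since right translation preserves the right Haar system; on the remaining arrows it is
zero. These relations, recorded in `RestrictIntertwines`, survive algebraic operations and norm
limits. Hence on the closed ⋆-algebra generated by the functions supported in H, compression is
multiplicative (`compressHom`) and injective (`RestrictIntertwines.eq_zero`). The cosets are open
because H is open, and second countability glues vanishing on each of them into vanishing almost
everywhere. An injective ⋆-homomorphism is isometric with closed range, so the image contains all of
C⋆ᵣ(H) (`reducedSubalgebra_restrictHaar_le`). The inclusion ι is the inverse, and the bimodule
property is multiplicativity of the compression when one factor lies in the image of ι.

Two analytic facts underlie this. The operators Ind v (f) are bounded uniformly in v, by Schur's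
test with the bounds sup_u ∫|f| dλᵘ and sup_u ∫|f⋆| dλᵘ. The operators [f]_G already form a
⋆-algebra, so their limits exhaust C⋆ᵣ(G). This rests on C_c(G) being closed under convolution
(`IsHaarSystem.convolution_mem_Cc`), which for non-Hausdorff G requires a localization argument. -/

/-! ### Complete positivity of compressions -/

theorem exists_eq_star_mul_self_of_nonneg {D : Type*} [NonUnitalCStarAlgebra D] [PartialOrder D]
    [StarOrderedRing D] {m : D} (hm : 0 ≤ m) : ∃ s : D, m = star s * s :=
  CStarAlgebra.nonneg_iff_eq_star_mul_self.mp hm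

/-- Take c to be the negative part of m. It is orthogonal to the positive part, so only -c survives
between the two factors c. Positivity of m is then proved by showing c = 0. -/
theorem exists_negPart_of_isSelfAdjoint {D : Type*} [NonUnitalCStarAlgebra D] [PartialOrder D]
    [StarOrderedRing D] (m : D) (hm : IsSelfAdjoint m) :
    ∃ c s : D, star c = c ∧ c = star s * s ∧ c * m * c = -(c * c * c) ∧ (c = 0 → 0 ≤ m) := by
  obtain ⟨s, hs⟩ := CStarAlgebra.nonneg_iff_eq_star_mul_self.mp (CFC.negPart_nonneg m)
  refine ⟨m⁻, s, (IsSelfAdjoint.of_nonneg (CFC.negPart_nonneg m)).star_eq, hs, ?_,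
    fun h => (CFC.negPart_eq_zero_iff m hm).mp h⟩
  nth_rewrite 2 [← CFC.posPart_sub_negPart m hm]
  rw [mul_sub, CFC.negPart_mul_posPart, zero_sub, neg_mul]

theorem eq_zero_of_mul_mul_self_eq_zero {D : Type*} [NonUnitalCStarAlgebra D] {c : D}
    (hc : star c = c) (h : c * c * c = 0) : c = 0 := by
  have h4 : star (c * c) * (c * c) = 0 := by
    rw [star_mul, hc, ← mul_assoc, h, zero_mul]
  have h5 : star c * c = 0 := by
    rw [hc]; exact (CStarRing.star_mul_self_eq_zero_iff _).mp h4
  exact (CStarRing.star_mul_self_eq_zero_iff _).mp h5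

open ContinuousLinearMap in
/-- A linear map between concrete C⋆-algebras that is given by compression by a bounded operator
is completely positive. -/
theorem cstarMatrix_map_nonneg_of_compression {A B E F : Type*} [NonUnitalCStarAlgebra A]
    [NonUnitalCStarAlgebra B] [PartialOrder A] [PartialOrder B] [StarOrderedRing A]
    [StarOrderedRing B] [NormedAddCommGroup E] [InnerProductSpace ℂ E] [CompleteSpace E]
    [NormedAddCommGroup F] [InnerProductSpace ℂ F] [CompleteSpace F]
    (πA : A →⋆ₙₐ[ℂ] (E →L[ℂ] E)) (πB : B →⋆ₙₐ[ℂ] (F →L[ℂ] F)) (hπB : Function.Injective πB)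
    (V : F →L[ℂ] E) (φ : A →ₗ[ℂ] B) (hφ : ∀ a, πB (φ a) = adjoint V ∘L πA a ∘L V)
    (k : ℕ) (M : CStarMatrix (Fin k) (Fin k) A) (hM : 0 ≤ M) : 0 ≤ M.map φ := by
  have hstar : ∀ a, φ (star a) = star (φ a) := by
    intro a
    apply hπB
    rw [map_star πB, hφ, hφ, map_star πA, star_eq_adjoint, star_eq_adjoint, adjoint_comp,
      adjoint_comp, adjoint_adjoint]
    rfl
  obtain ⟨N, hN⟩ : ∃ N, M = star N * N := exists_eq_star_mul_self_of_nonneg hM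
  set m : CStarMatrix (Fin k) (Fin k) B := M.map φ with hm
  have hmsa : IsSelfAdjoint m := by
    have hMsa : IsSelfAdjoint M := by rw [hN]; exact .star_mul_self N
    refine CStarMatrix.ext fun i j => ?_
    rw [CStarMatrix.star_apply, hm, CStarMatrix.map_apply, CStarMatrix.map_apply, ← hstar,
      ← CStarMatrix.star_apply, hMsa]
  obtain ⟨c, s, hcsa, hs, hcmc, hc0⟩ := exists_negPart_of_isSelfAdjoint m hmsa
  apply hc0
  -- Since c m c = -c³ = -Y⋆Y, while c m c is the image of a square under a compression, both sides
  -- must vanish. This is tested on diagonal entries and vectors of F, so no representation of the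
  -- matrix algebra is needed.
  set Y := s * c with hY
  have hcc : c * c * c = star Y * Y := by
    rw [hY, star_mul, hcsa]
    conv_lhs => rw [mul_assoc]; enter [2, 1]; rw [hs]
    simp only [mul_assoc]
  have key : star c * m * c = -(star Y * Y) := by rw [← hcc, hcsa, hcmc]
  have hYzero : Y = 0 := by
    refine CStarMatrix.ext fun i j => ?_
    apply hπB
    rw [CStarMatrix.zero_apply, map_zero]
    ext ξ
    have h1 := congrArg (fun X : CStarMatrix (Fin k) (Fin k) B => πB (X j j)) key
    simp only [CStarMatrix.mul_apply, CStarMatrix.star_apply, CStarMatrix.neg_apply, hm,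
      CStarMatrix.map_apply, hN, map_sum, map_mul, map_star, map_neg, hφ, Finset.sum_mul] at h1
    -- The first sum is the quadratic form of (c m c)_{jj} at ξ, with M = N⋆N inserted; the second
    -- is that of (Y⋆Y)_{jj}.
    have h2 : ∑ i, ‖∑ l, πA (N i l) (V (πB (c l j) ξ))‖ ^ 2 + ∑ i, ‖πB (Y i j) ξ‖ ^ 2 = 0 := by
      have h3 := congrArg (fun T : F →L[ℂ] F => inner ℂ ξ (T ξ)) h1
      simp only [sum_apply, neg_apply, ContinuousLinearMap.mul_def, star_eq_adjoint,
        adjoint_inner_right, ContinuousLinearMap.comp_apply, inner_sum, inner_neg_right, map_sum,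
        inner_self_eq_norm_sq_to_K] at h3
      have h4 : ∑ i, ((‖∑ l, πA (N i l) (V (πB (c l j) ξ))‖ ^ 2 : ℝ) : ℂ) =
          ∑ x, ∑ y, ∑ i, inner ℂ (πA (N i y) (V (πB (c y j) ξ)))
            (πA (N i x) (V (πB (c x j) ξ))) := by
        calc _ = ∑ i, inner ℂ (∑ l, πA (N i l) (V (πB (c l j) ξ)))
              (∑ l, πA (N i l) (V (πB (c l j) ξ))) := by
              simp only [inner_self_eq_norm_sq_to_K, Complex.ofReal_pow, Complex.coe_algebraMap]
          _ = _ := by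
              simp only [inner_sum, sum_inner]
              rw [Finset.sum_comm]
              exact Finset.sum_congr rfl fun x _ => Finset.sum_comm
      rw [← h4] at h3
      have h5 : ((∑ i, ‖∑ l, πA (N i l) (V (πB (c l j) ξ))‖ ^ 2 +
          ∑ i, ‖πB (Y i j) ξ‖ ^ 2 : ℝ) : ℂ) = 0 := by
        push_cast at h3 ⊢
        rw [h3]
        simp
      exact_mod_cast h5
    have h4 : ∑ i, ‖πB (Y i j) ξ‖ ^ 2 = 0 := by
      have := Finset.sum_nonneg (s := Finset.univ)
        (f := fun i => ‖∑ l, πA (N i l) (V (πB (c l j) ξ))‖ ^ 2) (fun i _ => by positivity)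
      have := Finset.sum_nonneg (s := Finset.univ)
        (f := fun i => ‖πB (Y i j) ξ‖ ^ 2) (fun i _ => by positivity)
      linarith
    have h5 := (Finset.sum_eq_zero_iff_of_nonneg (fun i _ => by positivity)).mp h4 i
      (Finset.mem_univ i)
    simpa using h5
  exact eq_zero_of_mul_mul_self_eq_zero hcsa (by rw [hcc, hYzero, mul_zero])

/-! ### Diagonal operators between Hilbert sums -/

section lpDiag

variable {I J : Type*} {E : I → Type*} {G : J → Type*} [∀ i, NormedAddCommGroup (E i)]
  [∀ i, NormedSpace ℂ (E i)] [∀ j, NormedAddCommGroup (G j)] [∀ j, NormedSpace ℂ (G j)]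
  {σ : J → I}

omit [∀ i, NormedSpace ℂ (E i)] [∀ j, NormedSpace ℂ (G j)] in
-- Injectivity of σ ensures that each component of ξ is charged at most once. The bound has |M|
-- because M may be negative when J is empty.
theorem lp_two_sum_le (hσ : Function.Injective σ) (ξ : lp E 2) (η : ∀ j, G j) (M : ℝ)
    (h : ∀ j, ‖η j‖ ≤ M * ‖ξ (σ j)‖) (s : Finset J) :
    ∑ j ∈ s, ‖η j‖ ^ (2 : ℝ≥0∞).toReal ≤ (|M| * ‖ξ‖) ^ (2 : ℝ≥0∞).toReal := by
  have h1 := lp.sum_rpow_le_norm_rpow (p := 2) (by norm_num) ξ (s.map ⟨σ, hσ⟩)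
  rw [Finset.sum_map] at h1
  simp only [ENNReal.toReal_ofNat, Function.Embedding.coeFn_mk, Real.rpow_ofNat] at h1 ⊢
  calc ∑ j ∈ s, ‖η j‖ ^ 2 ≤ ∑ j ∈ s, |M| ^ 2 * ‖ξ (σ j)‖ ^ 2 := by
        refine Finset.sum_le_sum fun j _ => ?_
        rw [← mul_pow]
        gcongr
        exact (h j).trans (by gcongr; exact le_abs_self M)
    _ ≤ (|M| * ‖ξ‖) ^ 2 := by rw [← Finset.mul_sum, mul_pow]; gcongr

omit [∀ i, NormedSpace ℂ (E i)] [∀ j, NormedSpace ℂ (G j)] in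
theorem memℓp_two_of_norm_le (hσ : Function.Injective σ) (ξ : lp E 2) (η : ∀ j, G j) (M : ℝ)
    (h : ∀ j, ‖η j‖ ≤ M * ‖ξ (σ j)‖) : Memℓp η 2 :=
  memℓp_gen' (lp_two_sum_le hσ ξ η M h)

/-- The operator between Hilbert sums given by a uniformly bounded family of operators between
summands. -/
def lpDiag (hσ : Function.Injective σ) (A : ∀ j, E (σ j) →L[ℂ] G j) (M : ℝ)
    (hA : ∀ j, ‖A j‖ ≤ M) : lp E 2 →L[ℂ] lp G 2 :=
  LinearMap.mkContinuous
    { toFun := fun ξ => ⟨fun j => A j (ξ (σ j)), memℓp_two_of_norm_le hσ ξ _ M fun j =>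
        (A j).le_of_opNorm_le (hA j) _⟩
      map_add' := fun ξ η => by ext j; exact map_add _ _ _
      map_smul' := fun c ξ => by ext j; exact map_smul _ _ _ } |M| fun ξ =>
    lp.norm_le_of_forall_sum_le (by norm_num) (by positivity)
      (lp_two_sum_le hσ ξ _ M fun j => (A j).le_of_opNorm_le (hA j) _)

theorem norm_lpDiag_le (hσ : Function.Injective σ) (A : ∀ j, E (σ j) →L[ℂ] G j) (M : ℝ)
    (hA : ∀ j, ‖A j‖ ≤ M) : ‖lpDiag hσ A M hA‖ ≤ |M| :=
  LinearMap.mkContinuous_norm_le _ (abs_nonneg _) _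

end lpDiag

/-! ### Schur's test for integral operators -/

section SchurKernel

open scoped NNReal

variable {X : Type*} [MeasurableSpace X] {μ : Measure X}

/-- Measurable kernels on `X × X` whose rows and columns are uniformly bounded in `L¹`. -/
structure IsSchurKernel (μ : Measure X) (k : X → X → ℂ) (M : ℝ≥0) : Prop where
  measurable : Measurable (Function.uncurry k)
  row_le : ∀ x, ∫⁻ t, ‖k x t‖ₑ ∂μ ≤ M
  col_le : ∀ t, ∫⁻ x, ‖k x t‖ₑ ∂μ ≤ M

/-- Cauchy–Schwarz for the factorization a u = a^{1/2} · (a^{1/2} u). -/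
theorem lintegral_mul_sq_le {a u : X → ℝ≥0∞} (ha : AEMeasurable a μ) (hu : AEMeasurable u μ) :
    (∫⁻ t, a t * u t ∂μ) ^ 2 ≤ (∫⁻ t, a t ∂μ) * ∫⁻ t, a t * u t ^ 2 ∂μ := by
  have h := ENNReal.lintegral_mul_le_Lp_mul_Lq μ (p := 2) (q := 2)
    (by constructor <;> norm_num) (f := fun t => a t ^ (1 / 2 : ℝ))
    (g := fun t => a t ^ (1 / 2 : ℝ) * u t) (by fun_prop) (by fun_prop)
  have hsq : ∀ b : ℝ≥0∞, (b ^ (1 / 2 : ℝ)) ^ (2 : ℝ) = b := fun b => by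
    rw [← ENNReal.rpow_mul]; norm_num
  have hsq' : ∀ b : ℝ≥0∞, b ^ (1 / 2 : ℝ) * b ^ (1 / 2 : ℝ) = b := fun b => by
    rw [← ENNReal.rpow_add_of_nonneg _ _ (by norm_num) (by norm_num)]; norm_num
  simp only [Pi.mul_apply, ← mul_assoc, hsq', ENNReal.mul_rpow_of_nonneg _ _ zero_le_two,
    hsq] at h
  calc (∫⁻ t, a t * u t ∂μ) ^ 2 ≤ _ := pow_le_pow_left' h 2
    _ = _ := by
      rw [mul_pow]
      simp only [← ENNReal.rpow_natCast, ← ENNReal.rpow_mul]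
      norm_num

namespace IsSchurKernel

variable {k l : X → X → ℂ} {M N : ℝ≥0}

theorem measurable_row (hk : IsSchurKernel μ k M) (x : X) : Measurable (k x) :=
  hk.measurable.of_uncurry_left

/-- This is the kernel of the adjoint operator; the row and column bounds change places. -/
theorem conj_swap (hk : IsSchurKernel μ k M) : IsSchurKernel μ (fun x t => star (k t x)) M where
  measurable := continuous_star.measurable.comp (hk.measurable.comp measurable_swap)
  row_le x := by simpa using hk.col_le x
  col_le x := by simpa using hk.row_le x

variable [SFinite μ]

/-- Changing u on a null set alters the integral for no x. With a measurable version of u the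
function is thus measurable outright, not merely almost everywhere. -/
theorem measurable_lintegral (hk : IsSchurKernel μ k M) {u : X → ℝ≥0∞} (hu : AEMeasurable u μ) :
    Measurable fun x => ∫⁻ t, ‖k x t‖ₑ * u t ∂μ := by
  have : (fun x => ∫⁻ t, ‖k x t‖ₑ * u t ∂μ) = fun x => ∫⁻ t, ‖k x t‖ₑ * hu.mk u t ∂μ := by
    ext x
    refine lintegral_congr_ae ?_
    filter_upwards [hu.ae_eq_mk] with t ht
    rw [ht]
  rw [this]
  refine Measurable.lintegral_prod_right' (f := fun p : X × X => ‖k p.1 p.2‖ₑ * hu.mk u p.2) ?_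
  exact hk.measurable.enorm.mul (hu.measurable_mk.comp measurable_snd)

/-- Schur's test: weighted Cauchy–Schwarz in t uses the row bound, then Tonelli and the column bound
give the second factor M. -/
theorem lintegral_sq_le (hk : IsSchurKernel μ k M) {u : X → ℝ≥0∞} (hu : AEMeasurable u μ) :
    ∫⁻ x, (∫⁻ t, ‖k x t‖ₑ * u t ∂μ) ^ 2 ∂μ ≤ (M : ℝ≥0∞) ^ 2 * ∫⁻ t, u t ^ 2 ∂μ := by
  calc ∫⁻ x, (∫⁻ t, ‖k x t‖ₑ * u t ∂μ) ^ 2 ∂μ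
      ≤ ∫⁻ x, M * ∫⁻ t, ‖k x t‖ₑ * u t ^ 2 ∂μ ∂μ := by
        refine lintegral_mono fun x => (lintegral_mul_sq_le ?_ hu).trans ?_
        · exact (hk.measurable_row x).enorm.aemeasurable
        · gcongr
          exact hk.row_le x
    _ = M * ∫⁻ t, ∫⁻ x, ‖k x t‖ₑ * u t ^ 2 ∂μ ∂μ := by
        rw [lintegral_const_mul _ (hk.measurable_lintegral (hu.pow_const 2)),
          lintegral_lintegral_swap]
        exact hk.measurable.enorm.aemeasurable.mul (hu.comp_snd.pow_const 2)
    _ ≤ M * ∫⁻ t, M * u t ^ 2 ∂μ := by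
        gcongr with t
        rw [lintegral_mul_const'']
        · gcongr
          exact hk.col_le t
        · exact (hk.measurable.comp (measurable_id.prodMk measurable_const)).enorm.aemeasurable
    _ = _ := by
        rw [lintegral_const_mul'' _ (hu.pow_const 2), ← mul_assoc, sq]

omit [SFinite μ] in
theorem lintegral_enorm_sq_lt_top {ξ : X → ℂ} (hξ : MemLp ξ 2 μ) :
    ∫⁻ t, ‖ξ t‖ₑ ^ 2 ∂μ < ∞ := by
  have := lintegral_rpow_enorm_lt_top_of_eLpNorm_lt_top (p := 2) (by norm_num) (by norm_num) hξ.2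
  simpa using this

theorem ae_lintegral_lt_top (hk : IsSchurKernel μ k M) {u : X → ℝ≥0∞} (hu : AEMeasurable u μ)
    (hu2 : ∫⁻ t, u t ^ 2 ∂μ < ∞) : ∀ᵐ x ∂μ, ∫⁻ t, ‖k x t‖ₑ * u t ∂μ < ∞ := by
  have h := ae_lt_top ((hk.measurable_lintegral hu).pow_const 2)
    ((hk.lintegral_sq_le hu).trans_lt (by finiteness)).ne
  filter_upwards [h] with x hx
  simpa using hx

theorem ae_integrable (hk : IsSchurKernel μ k M) {ξ : X → ℂ} (hξ : MemLp ξ 2 μ) :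
    ∀ᵐ x ∂μ, Integrable (fun t => k x t * ξ t) μ := by
  filter_upwards [hk.ae_lintegral_lt_top hξ.1.enorm (lintegral_enorm_sq_lt_top hξ)] with x hx
  refine ⟨(hk.measurable_row x).aestronglyMeasurable.mul hξ.1, ?_⟩
  simpa [HasFiniteIntegral, enorm_mul] using hx

theorem aestronglyMeasurable_integral (hk : IsSchurKernel μ k M) {ξ : X → ℂ}
    (hξ : AEStronglyMeasurable ξ μ) :
    AEStronglyMeasurable (fun x => ∫ t, k x t * ξ t ∂μ) μ :=
  AEStronglyMeasurable.integral_prod_right' (f := fun p : X × X => k p.1 p.2 * ξ p.2)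
    (hk.measurable.aestronglyMeasurable.mul hξ.comp_snd)

theorem eLpNorm_integral_le (hk : IsSchurKernel μ k M) {ξ : X → ℂ}
    (hξ : AEStronglyMeasurable ξ μ) :
    eLpNorm (fun x => ∫ t, k x t * ξ t ∂μ) 2 μ ≤ M * eLpNorm ξ 2 μ := by
  have h := (lintegral_mono fun x => pow_le_pow_left' (enorm_integral_le_lintegral_enorm
    (fun t => k x t * ξ t)) 2).trans
    (by simpa only [enorm_mul] using hk.lintegral_sq_le hξ.enorm)
  rw [eLpNorm_eq_lintegral_rpow_enorm_toReal (by norm_num) (by norm_num),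
    eLpNorm_eq_lintegral_rpow_enorm_toReal (by norm_num) (by norm_num)]
  simp only [ENNReal.toReal_ofNat, ENNReal.rpow_ofNat]
  calc _ ≤ ((M : ℝ≥0∞) ^ 2 * ∫⁻ t, ‖ξ t‖ₑ ^ 2 ∂μ) ^ (1 / 2 : ℝ) :=
        ENNReal.rpow_le_rpow h (by norm_num)
    _ = _ := by
        rw [ENNReal.mul_rpow_of_nonneg _ _ (by norm_num), ← ENNReal.rpow_natCast,
          ← ENNReal.rpow_mul]
        norm_num

theorem memLp_integral (hk : IsSchurKernel μ k M) {ξ : X → ℂ} (hξ : MemLp ξ 2 μ) :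
    MemLp (fun x => ∫ t, k x t * ξ t ∂μ) 2 μ :=
  ⟨hk.aestronglyMeasurable_integral hξ.1,
    (hk.eLpNorm_integral_le hξ.1).trans_lt (ENNReal.mul_lt_top (by simp) hξ.2)⟩

/-- The integral operator of a Schur kernel. -/
def toCLM (hk : IsSchurKernel μ k M) : Lp ℂ 2 μ →L[ℂ] Lp ℂ 2 μ :=
  LinearMap.mkContinuous
    { toFun := fun ξ => (hk.memLp_integral (Lp.memLp ξ)).toLp _
      map_add' := fun ξ η => by
        rw [← MemLp.toLp_add]
        apply MemLp.toLp_congr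
        filter_upwards [hk.ae_integrable (Lp.memLp ξ), hk.ae_integrable (Lp.memLp η)] with x h1 h2
        rw [Pi.add_apply, ← integral_add h1 h2]
        refine integral_congr_ae ?_
        filter_upwards [Lp.coeFn_add ξ η] with t ht
        rw [ht, Pi.add_apply, mul_add]
      map_smul' := fun c ξ => by
        rw [RingHom.id_apply, ← MemLp.toLp_const_smul]
        apply MemLp.toLp_congr
        refine .of_forall fun x => ?_
        rw [Pi.smul_apply, smul_eq_mul, ← integral_const_mul]
        refine integral_congr_ae ?_
        filter_upwards [Lp.coeFn_smul c ξ] with t ht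
        rw [ht, Pi.smul_apply, smul_eq_mul, mul_left_comm] } M fun ξ => by
    rw [LinearMap.coe_mk, AddHom.coe_mk, Lp.norm_toLp, Lp.norm_def, ← ENNReal.coe_toReal,
      ← ENNReal.toReal_mul]
    exact ENNReal.toReal_mono (ENNReal.mul_ne_top (by simp) (Lp.eLpNorm_ne_top ξ))
      (hk.eLpNorm_integral_le (Lp.memLp ξ).1)

theorem norm_toCLM_le (hk : IsSchurKernel μ k M) : ‖hk.toCLM‖ ≤ M :=
  LinearMap.mkContinuous_norm_le _ M.2 _

theorem toCLM_ae (hk : IsSchurKernel μ k M) (ξ : Lp ℂ 2 μ) :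
    hk.toCLM ξ =ᵐ[μ] fun x => ∫ t, k x t * ξ t ∂μ :=
  (hk.memLp_integral (Lp.memLp ξ)).coeFn_toLp

/-- Both sides are iterated integrals of conj(k(x,t) ξ(t)) η(x), in the two orders. Fubini applies
because x ↦ ∫ |k(x,t)| |ξ(t)| dt is in L² by Schur's test and η is in L². -/
theorem inner_toCLM (hk : IsSchurKernel μ k M) (ξ η : Lp ℂ 2 μ) :
    inner ℂ (hk.toCLM ξ) η = inner ℂ ξ (hk.conj_swap.toCLM η) := by
  rw [L2.inner_def, L2.inner_def]
  have h1 : ∫ x, inner ℂ (hk.toCLM ξ x) (η x) ∂μ =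
      ∫ x, ∫ t, star (k x t) * star (ξ t) * η x ∂μ ∂μ := by
    refine integral_congr_ae ?_
    filter_upwards [hk.toCLM_ae ξ] with x hx
    rw [hx, integral_mul_const, RCLike.inner_apply, mul_comm, ← integral_conj]
    simp
  have h2 : ∫ t, inner ℂ (ξ t) (hk.conj_swap.toCLM η t) ∂μ =
      ∫ t, ∫ x, star (k x t) * star (ξ t) * η x ∂μ ∂μ := by
    refine integral_congr_ae ?_
    filter_upwards [hk.conj_swap.toCLM_ae η] with t ht
    rw [ht, RCLike.inner_apply, ← integral_mul_const]
    congr 1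
    ext x
    simp only [RCLike.star_def]
    ring
  rw [h1, h2]
  apply integral_integral_swap
  refine ⟨?_, ?_⟩
  · exact ((continuous_star.measurable.comp hk.measurable).aestronglyMeasurable.mul
      (Lp.memLp ξ).1.star.comp_snd).mul (Lp.memLp η).1.comp_fst
  · have hle := ENNReal.lintegral_mul_le_Lp_mul_Lq μ (p := 2) (q := 2)
      (by constructor <;> norm_num) (f := fun x => ∫⁻ t, ‖k x t‖ₑ * ‖ξ t‖ₑ ∂μ)
      (g := fun x => ‖η x‖ₑ) (hk.measurable_lintegral (Lp.memLp ξ).1.enorm).aemeasurable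
      (Lp.memLp η).1.enorm
    rw [hasFiniteIntegral_iff_enorm, lintegral_prod _ (by
      exact (((continuous_star.measurable.comp hk.measurable).aestronglyMeasurable.mul
        (Lp.memLp ξ).1.star.comp_snd).mul (Lp.memLp η).1.comp_fst).enorm)]
    calc _ = ∫⁻ x, (∫⁻ t, ‖k x t‖ₑ * ‖ξ t‖ₑ ∂μ) * ‖η x‖ₑ ∂μ := by
          refine lintegral_congr fun x => ?_
          rw [← lintegral_mul_const'']
          · simp [Function.uncurry, enorm_mul]
          · exact (hk.measurable_row x).enorm.aemeasurable.mul (Lp.memLp ξ).1.enorm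
      _ < ∞ := by
          refine hle.trans_lt (ENNReal.mul_lt_top ?_ ?_)
          · refine ENNReal.rpow_lt_top_of_nonneg (by norm_num) (ne_of_lt ?_)
            simp only [ENNReal.rpow_ofNat]
            refine (hk.lintegral_sq_le (Lp.memLp ξ).1.enorm).trans_lt
              (ENNReal.mul_lt_top (by simp) (lintegral_enorm_sq_lt_top (Lp.memLp ξ)))
          · refine ENNReal.rpow_lt_top_of_nonneg (by norm_num) (ne_of_lt ?_)
            simpa using lintegral_enorm_sq_lt_top (Lp.memLp η)

/-- Schur's test applied twice, to |l| and |ξ| and then to |k|, makes the double integral absolutely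
convergent for almost every x; Fubini then holds for that x. -/
theorem ae_integral_mul_integral (hk : IsSchurKernel μ k M) (hl : IsSchurKernel μ l N)
    {ξ : X → ℂ} (hξ : MemLp ξ 2 μ) :
    ∀ᵐ x ∂μ, ∫ s, k x s * ∫ t, l s t * ξ t ∂μ ∂μ = ∫ t, (∫ s, k x s * l s t ∂μ) * ξ t ∂μ := by
  have hfin := hk.ae_lintegral_lt_top (hl.measurable_lintegral hξ.1.enorm).aemeasurable
    ((hl.lintegral_sq_le hξ.1.enorm).trans_lt
      (ENNReal.mul_lt_top (by simp) (lintegral_enorm_sq_lt_top hξ)))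
  filter_upwards [hfin] with x hx
  simp only [← integral_const_mul, ← integral_mul_const]
  have hmeas : AEStronglyMeasurable (Function.uncurry fun s t => k x s * (l s t * ξ t))
      (μ.prod μ) :=
    (((hk.measurable_row x).comp measurable_fst).aestronglyMeasurable).mul
      (hl.measurable.aestronglyMeasurable.mul hξ.1.comp_snd)
  rw [integral_integral_swap]
  · simp only [mul_assoc]
  · refine ⟨hmeas, ?_⟩
    rw [hasFiniteIntegral_iff_enorm, lintegral_prod _ hmeas.enorm]
    convert hx using 1
    refine lintegral_congr fun s => ?_
    rw [← lintegral_const_mul'']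
    · simp [Function.uncurry, enorm_mul]
    · exact (hl.measurable_row s).enorm.aemeasurable.mul hξ.1.enorm

end IsSchurKernel

end SchurKernel

/-! ### Compactly supported functions without the Hausdorff axiom -/

section CompactSupport

variable {Y Z : Type*} [TopologicalSpace Y] [TopologicalSpace Z]

/-- `f` is continuous on the Hausdorff open set `U` and vanishes off the compact set `K ⊆ U`. -/
structure IsCcOn (f : Y → ℂ) (U K : Set Y) : Prop where
  isOpen : IsOpen U
  t2 : T2Space U
  isCompact : IsCompact K
  subset : K ⊆ U
  eq_zero : ∀ y, y ∉ K → f y = 0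
  continuousOn : ContinuousOn f U

theorem t2Space_of_subset {U V : Set Y} (hV : T2Space V) (h : U ⊆ V) : T2Space U :=
  T2Space.of_injective_continuous (Set.inclusion_injective h) (continuous_inclusion h)

/-- The support inside U becomes a compact subset K of Y. When Y is not Hausdorff, K need not be
closed in Y, only in U. -/
theorem mem_CcZero_iff {f : Y → ℂ} : f ∈ CcZero Y ↔ ∃ U K, IsCcOn f U K := by
  constructor
  · rintro ⟨U, hU, hT, h0, hc, hs⟩
    refine ⟨U, Subtype.val '' tsupport (U.domRestrict f), hU, hT, hs.isCompact.image
      continuous_subtype_val, by rintro _ ⟨y, -, rfl⟩; exact y.2, fun y hy => ?_,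
      continuousOn_iff_continuous_domRestrict.mpr hc⟩
    by_cases hyU : y ∈ U
    · by_contra hne
      exact hy ⟨⟨y, hyU⟩, subset_tsupport _ hne, rfl⟩
    · exact h0 y hyU
  · rintro ⟨U, K, h⟩
    have := h.t2
    refine ⟨U, h.isOpen, h.t2, fun y hy => h.eq_zero y fun hK => hy (h.subset hK),
      continuousOn_iff_continuous_domRestrict.mp h.continuousOn, ?_⟩
    refine HasCompactSupport.intro (K := Subtype.val ⁻¹' K) ?_ fun y hy => h.eq_zero _ hy
    rw [IsInducing.subtypeVal.isCompact_preimage_iff (by simpa using h.subset)]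
    exact h.isCompact

namespace IsCcOn

variable {f : Y → ℂ} {U V K : Set Y}

theorem mem_Cc (h : IsCcOn f U K) : f ∈ Cc Y :=
  Submodule.subset_span (mem_CcZero_iff.mpr ⟨U, K, h⟩)

theorem comp_left (h : IsCcOn f U K) {φ : ℂ → ℂ} (hφ : Continuous φ) (h0 : φ 0 = 0) :
    IsCcOn (fun y => φ (f y)) U K :=
  ⟨h.isOpen, h.t2, h.isCompact, h.subset, fun y hy => by rw [h.eq_zero y hy, h0],
    hφ.comp_continuousOn h.continuousOn⟩

theorem mul_left (h : IsCcOn f U K) {g : Y → ℂ} (hg : ContinuousOn g U) :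
    IsCcOn (fun y => f y * g y) U K :=
  ⟨h.isOpen, h.t2, h.isCompact, h.subset, fun y hy => by rw [h.eq_zero y hy, zero_mul],
    h.continuousOn.mul hg⟩

theorem comp_isClosedEmbedding (h : IsCcOn f U K) {j : Z → Y} (hj : IsClosedEmbedding j) :
    IsCcOn (f ∘ j) (j ⁻¹' U) (j ⁻¹' K) where
  isOpen := h.isOpen.preimage hj.continuous
  t2 := by
    have := h.t2
    refine T2Space.of_injective_continuous (f := Set.MapsTo.restrict j (j ⁻¹' U) U
      (Set.mapsTo_preimage j U)) ?_ (hj.continuous.continuousOn.mapsToRestrict _)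
    exact (Set.mapsTo_preimage j U).restrict_inj.mpr hj.injective.injOn
  isCompact := hj.isCompact_preimage h.isCompact
  subset := Set.preimage_mono h.subset
  eq_zero z hz := h.eq_zero _ hz
  continuousOn := h.continuousOn.comp hj.continuous.continuousOn (Set.mapsTo_preimage j U)

theorem extend_isOpenEmbedding {g : Z → ℂ} {V L : Set Z} (h : IsCcOn g V L) {j : Z → Y}
    (hj : IsOpenEmbedding j) : IsCcOn (Function.extend j g 0) (j '' V) (j '' L) where
  isOpen := hj.isOpenMap _ h.isOpen
  t2 := by
    have := h.t2
    exact (hj.isEmbedding.homeomorphImage V).symm.isEmbedding.t2Space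
  isCompact := h.isCompact.image hj.continuous
  subset := Set.image_mono h.subset
  eq_zero y hy := by
    by_cases hy' : ∃ z, j z = y
    · obtain ⟨z, rfl⟩ := hy'
      rw [hj.injective.extend_apply]
      exact h.eq_zero z fun hz => hy ⟨z, hz, rfl⟩
    · rw [Function.extend_apply' _ _ _ hy', Pi.zero_apply]
  continuousOn := by
    rintro _ ⟨z, hz, rfl⟩
    refine ContinuousAt.continuousWithinAt ?_
    rw [← hj.continuousAt_iff, Function.extend_comp hj.injective]
    exact h.continuousOn.continuousAt (h.isOpen.mem_nhds hz)

theorem continuous [T2Space Y] (h : IsCcOn f U K) : Continuous f := by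
  rw [continuous_iff_continuousAt]
  intro y
  by_cases hy : y ∈ U
  · exact h.continuousOn.continuousAt (h.isOpen.mem_nhds hy)
  · have hev : f =ᶠ[𝓝 y] 0 := by
      filter_upwards [h.isCompact.isClosed.isOpen_compl.mem_nhds fun hK => hy (h.subset hK)]
        with z hz using h.eq_zero z hz
    exact continuousAt_const.congr hev.symm

/-- The function may be discontinuous on Y, but it is continuous on the open set U and zero
elsewhere, hence Borel. -/
theorem measurable [MeasurableSpace Y] [BorelSpace Y] (h : IsCcOn f U K) : Measurable f := by
  classical
  have h0 : f = U.piecewise f 0 := by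
    ext y
    by_cases hy : y ∈ U
    · rw [Set.piecewise_eq_of_mem _ _ _ hy]
    · rw [Set.piecewise_eq_of_notMem _ _ _ hy, h.eq_zero y fun hK => hy (h.subset hK),
        Pi.zero_apply]
  rw [h0]
  exact h.continuousOn.measurable_piecewise continuousOn_const h.isOpen.measurableSet

end IsCcOn

theorem Cc_induction {p : (Y → ℂ) → Prop} {f : Y → ℂ} (hf : f ∈ Cc Y)
    (hmem : ∀ f U K, IsCcOn f U K → p f) (hzero : p 0) (hadd : ∀ f g, p f → p g → p (f + g))
    (hsmul : ∀ (c : ℂ) f, p f → p (c • f)) : p f :=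
  Submodule.span_induction (fun f hf => by
    obtain ⟨U, K, h⟩ := mem_CcZero_iff.mp hf
    exact hmem f U K h) hzero (fun f g _ _ => hadd f g) (fun c f _ => hsmul c f) hf

theorem Cc_comp_isClosedEmbedding {f : Y → ℂ} (hf : f ∈ Cc Y) {j : Z → Y}
    (hj : IsClosedEmbedding j) : f ∘ j ∈ Cc Z :=
  Cc_induction (p := fun f => f ∘ j ∈ Cc Z) hf (fun _ _ _ h => (h.comp_isClosedEmbedding hj).mem_Cc)
    (zero_mem _) (fun _ _ hf hg => add_mem hf hg) (fun c _ hf => Submodule.smul_mem _ c hf)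

theorem Cc_extend_isOpenEmbedding {g : Z → ℂ} (hg : g ∈ Cc Z) {j : Z → Y}
    (hj : IsOpenEmbedding j) : Function.extend j g 0 ∈ Cc Y := by
  refine Cc_induction (p := fun g => Function.extend j g 0 ∈ Cc Y) hg
    (fun f U K h => (h.extend_isOpenEmbedding hj).mem_Cc) ?_ ?_ ?_
  · rw [show Function.extend j (0 : Z → ℂ) (0 : Y → ℂ) = 0 from Function.extend_zero j]
    exact zero_mem _
  · intro f g hf hg
    have := Function.extend_add j f g (0 : Y → ℂ) 0
    rw [add_zero] at this
    rw [this]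
    exact add_mem hf hg
  · intro c f hf
    have := Function.extend_smul c j f (0 : Y → ℂ)
    rw [smul_zero] at this
    rw [this]
    exact Submodule.smul_mem _ c hf

theorem Cc_comp_left_star {f : Y → ℂ} (hf : f ∈ Cc Y) : (fun y => star (f y)) ∈ Cc Y := by
  refine Cc_induction (p := fun f : Y → ℂ => (fun y => star (f y)) ∈ Cc Y) hf
    (fun f U K h => (h.comp_left continuous_star (star_zero _)).mem_Cc) ?_ ?_ ?_
  · convert zero_mem (Cc Y)
    simp
  · intro f g hf hg
    convert add_mem hf hg using 1
    ext y
    simp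
  · intro c f hf
    convert Submodule.smul_mem _ (star c) hf using 1
    ext y
    simp

theorem Cc_measurable [MeasurableSpace Y] [BorelSpace Y] {f : Y → ℂ} (hf : f ∈ Cc Y) :
    Measurable f :=
  Cc_induction hf (fun _ _ _ h => h.measurable) measurable_zero (fun _ _ hf hg => hf.add hg)
    (fun c _ hf => hf.const_smul c)

theorem mem_Cc_iff_of_t2Space [T2Space Y] {f : Y → ℂ} :
    f ∈ Cc Y ↔ Continuous f ∧ HasCompactSupport f := by
  constructor
  · intro hf
    refine Cc_induction (p := fun f => Continuous f ∧ HasCompactSupport f) hf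
      (fun f U K h => ⟨h.continuous, .intro h.isCompact h.eq_zero⟩)
      ⟨continuous_zero, .zero⟩ (fun f g hf hg => ⟨hf.1.add hg.1, hf.2.add hg.2⟩)
      (fun c f hf => ⟨hf.1.const_smul c, hf.2.comp_left (g := fun z => c • z) (smul_zero c)⟩)
  · rintro ⟨h1, h2⟩
    exact IsCcOn.mem_Cc (U := Set.univ) (K := tsupport f) ⟨isOpen_univ, inferInstance, h2,
      Set.subset_univ _, fun y hy => image_eq_zero_of_notMem_tsupport hy, h1.continuousOn⟩

/-- A submodule contains `Cc Y` as soon as it contains all sufficiently localized functions. -/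
theorem Cc_le_of_local [LocallyCompactSpace Y] (S : Submodule ℂ (Y → ℂ))
    (h : ∀ y, ∃ O, IsOpen O ∧ y ∈ O ∧ ∀ f U K, IsCcOn f U K → U ⊆ O → f ∈ S) : Cc Y ≤ S := by
  refine Submodule.span_le.mpr fun f hf => ?_
  obtain ⟨U, K, hf⟩ := mem_CcZero_iff.mp hf
  choose O hO hyO hS using h
  have := hf.t2
  have : LocallyCompactSpace U := hf.isOpen.locallyCompactSpace
  have hK' : IsCompact ((↑) ⁻¹' K : Set U) := by
    rw [IsInducing.subtypeVal.isCompact_preimage_iff (by simpa using hf.subset)]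
    exact hf.isCompact
  obtain ⟨t, ht⟩ := hK'.elim_finite_subcover
    (fun y : U => (Subtype.val ⁻¹' O (y : Y) : Set U))
    (fun y => (hO y).preimage continuous_subtype_val) fun y _ => Set.mem_iUnion.mpr ⟨y, hyO y⟩
  -- The partition of unity lives on U, which is locally compact Hausdorff, and sums to 1 only on K.
  -- The pieces ρᵢ f, extended by zero, are continuous on U ∩ Oᵢ with compact support there.
  obtain ⟨ρ, hρ, -⟩ := PartitionOfUnity.exists_isSubordinate_of_locallyFinite_t2space hK'
    (fun y : t => (Subtype.val ⁻¹' O y.1.1 : Set U)) (fun y => (hO y).preimage continuous_subtype_val)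
    (locallyFinite_of_finite _) (by simpa [Set.iUnion_subtype] using ht)
  classical
  let g : t → Y → ℂ := fun i y => if hy : y ∈ U then (ρ i ⟨y, hy⟩ : ℂ) * f y else 0
  have hg : ∀ i, g i ∈ S := by
    intro i
    refine hS i.1.1 (g i) (U ∩ O i.1.1) ((↑) '' (((↑) ⁻¹' K : Set U) ∩ tsupport (ρ i))) ?_
      Set.inter_subset_right
    refine ⟨hf.isOpen.inter (hO i.1.1), t2Space_of_subset hf.t2 Set.inter_subset_left,
      (hK'.inter_right (isClosed_tsupport _)).image continuous_subtype_val, ?_, ?_, ?_⟩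
    · rintro _ ⟨y, ⟨-, hy⟩, rfl⟩
      exact ⟨y.2, hρ i hy⟩
    · intro y hy
      by_cases hyU : y ∈ U
      · simp only [g, dif_pos hyU]
        by_cases hyK : y ∈ K
        · have : (⟨y, hyU⟩ : U) ∉ tsupport (ρ i) := fun h' => hy ⟨⟨y, hyU⟩, ⟨hyK, h'⟩, rfl⟩
          rw [image_eq_zero_of_notMem_tsupport this]
          simp
        · rw [hf.eq_zero y hyK, mul_zero]
      · simp only [g, dif_neg hyU]
    · refine ContinuousOn.mono ?_ (Set.inter_subset_left : U ∩ O i.1.1 ⊆ U)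
      rw [continuousOn_iff_continuous_domRestrict]
      have : U.domRestrict (g i) = fun y : U => (ρ i y : ℂ) * U.domRestrict f y := by
        ext y
        simp [g]
      rw [this]
      exact (Complex.continuous_ofReal.comp (ρ i).continuous).mul
        (continuousOn_iff_continuous_domRestrict.mp hf.continuousOn)
  have hsum : f = ∑ i, g i := by
    ext y
    rw [Finset.sum_apply]
    by_cases hyU : y ∈ U
    · simp only [g, dif_pos hyU]
      by_cases hyK : y ∈ K
      · have h1 := ρ.sum_eq_one (x := ⟨y, hyU⟩) hyK
        rw [finsum_eq_sum_of_fintype] at h1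
        rw [← Finset.sum_mul, ← Complex.ofReal_sum, h1, Complex.ofReal_one, one_mul]
      · simp [hf.eq_zero y hyK]
    · simp [g, dif_neg hyU, hf.eq_zero y fun hK => hyU (hf.subset hK)]
  rw [hsum]
  exact sum_mem fun i _ => hg i

end CompactSupport

/-! ### Extension from closed subspaces -/

section Extension

variable {Y Z : Type*} [TopologicalSpace Y] [TopologicalSpace Z]

/-- A compact set is closed in the Hausdorff space V, so f vanishes in a neighbourhood of every
point of V outside U. -/
theorem IsCcOn.mono_right {f : Y → ℂ} {U V K : Set Y} (h : IsCcOn f U K) (hV : IsOpen V)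
    (hT : T2Space V) (hUV : U ⊆ V) : IsCcOn f V K where
  isOpen := hV
  t2 := hT
  isCompact := h.isCompact
  subset := h.subset.trans hUV
  eq_zero := h.eq_zero
  continuousOn := by
    intro y hy
    by_cases hyU : y ∈ U
    · exact (h.continuousOn.continuousAt (h.isOpen.mem_nhds hyU)).continuousWithinAt
    · have hK : IsCompact (Subtype.val ⁻¹' K : Set V) := by
        rw [IsInducing.subtypeVal.isCompact_preimage_iff (by simpa using h.subset.trans hUV)]
        exact h.isCompact
      have hev : f =ᶠ[𝓝 y] 0 := by
        filter_upwards [(hV.isOpenMap_subtype_val _ hK.isClosed.isOpen_compl).mem_nhds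
          ⟨⟨y, hy⟩, fun hyK => hyU (h.subset hyK), rfl⟩]
        rintro _ ⟨z, hz, rfl⟩
        exact h.eq_zero _ hz
      exact (continuousAt_const.congr hev.symm).continuousWithinAt

/-- Tietze's theorem inside A, which is normal as a second countable locally compact Hausdorff
space. Nothing is claimed outside A or about supports. -/
theorem exists_continuousOn_extension [LocallyCompactSpace Y] [SecondCountableTopology Y]
    {j : Z → Y} (hj : IsClosedEmbedding j) {A : Set Y} (hA : IsOpen A) (hT : T2Space A)
    {φ : Z → ℂ} (hφ : ContinuousOn φ (j ⁻¹' A)) :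
    ∃ ψ : Y → ℂ, ContinuousOn ψ A ∧ ∀ z, j z ∈ A → ψ (j z) = φ z := by
  have : LocallyCompactSpace A := hA.locallyCompactSpace
  obtain ⟨g, hg⟩ := ContinuousMap.exists_extension (hj.restrictPreimage A)
    ⟨_, continuousOn_iff_continuous_domRestrict.mp hφ⟩
  classical
  refine ⟨fun y => if h : y ∈ A then g ⟨y, h⟩ else 0, ?_, fun z hz => ?_⟩
  · rw [continuousOn_iff_continuous_domRestrict]
    convert g.continuous using 1
    ext y
    simp
  · have := DFunLike.congr_fun hg ⟨z, hz⟩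
    simp only [dif_pos hz]
    exact this

theorem exists_isCcOn_one [LocallyCompactSpace Y] {A K : Set Y} (hA : IsOpen A) (hT : T2Space A)
    (hK : IsCompact K) (hKA : K ⊆ A) : ∃ χ : Y → ℂ, ∃ L, IsCcOn χ A L ∧ ∀ y ∈ K, χ y = 1 := by
  have : LocallyCompactSpace A := hA.locallyCompactSpace
  have hK' : IsCompact (Subtype.val ⁻¹' K : Set A) := by
    rw [IsInducing.subtypeVal.isCompact_preimage_iff (by simpa using hKA)]
    exact hK
  obtain ⟨f, hf1, hf2, -⟩ := exists_continuousMap_one_of_isCompact_subset_isOpen hK' isOpen_univ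
    (Set.subset_univ _)
  have hc : IsCcOn (fun y => (f y : ℂ)) Set.univ (tsupport f) :=
    ⟨isOpen_univ, inferInstance, hf2, Set.subset_univ _,
      fun y hy => by rw [image_eq_zero_of_notMem_tsupport hy, Complex.ofReal_zero],
      (Complex.continuous_ofReal.comp f.continuous).continuousOn⟩
  have := hc.extend_isOpenEmbedding hA.isOpenEmbedding_subtypeVal
  rw [Set.image_univ, Subtype.range_val] at this
  refine ⟨_, _, this, fun y hy => ?_⟩
  have h := Subtype.val_injective.extend_apply (fun y : A => (f y : ℂ)) (0 : Y → ℂ) ⟨y, hKA hy⟩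
  rw [h, hf1 (by exact hy), Pi.one_apply, Complex.ofReal_one]

/-- Compactly supported continuous functions extend from closed subspaces. -/
theorem exists_Cc_extension [LocallyCompactSpace Y] [SecondCountableTopology Y]
    [LocallyCompactSpace Z] (hY : ∀ y : Y, ∃ A, IsOpen A ∧ y ∈ A ∧ T2Space A) {j : Z → Y}
    (hj : IsClosedEmbedding j) {φ : Z → ℂ} (hφ : φ ∈ Cc Z) : ∃ f ∈ Cc Y, f ∘ j = φ := by
  suffices Cc Z ≤ (Cc Y).map (LinearMap.funLeft ℂ ℂ j) from this hφ
  refine Cc_le_of_local _ fun z => ?_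
  obtain ⟨A, hA, hzA, hT⟩ := hY (j z)
  refine ⟨j ⁻¹' A, hA.preimage hj.continuous, hzA, fun f U K h hU => ?_⟩
  have hT' : T2Space (j ⁻¹' A) :=
    T2Space.of_injective_continuous ((Set.mapsTo_preimage j A).restrict_inj.mpr hj.injective.injOn)
      (hj.continuous.continuousOn.mapsToRestrict _)
  -- Tietze's theorem on A needs f to be continuous on all of j⁻¹(A), not only on U.
  have h' := h.mono_right (hA.preimage hj.continuous) hT' hU
  obtain ⟨ψ, hψ, hψf⟩ := exists_continuousOn_extension hj hA hT h'.continuousOn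
  obtain ⟨χ, L, hχ, hχ1⟩ := exists_isCcOn_one hA hT (h.isCompact.image hj.continuous)
    (Set.image_subset_iff.mpr h'.subset)
  -- The extension is χψ: the cut-off χ is 1 on j(K), and along j the function ψ already vanishes on
  -- the part of A outside j(K).
  refine ⟨_, (hχ.mul_left hψ).mem_Cc, ?_⟩
  ext z
  simp only [LinearMap.funLeft_apply]
  by_cases hz : z ∈ K
  · rw [hχ1 _ ⟨z, hz, rfl⟩, one_mul, hψf z (h'.subset hz)]
  · rw [h.eq_zero z hz]
    by_cases hzA : j z ∈ A
    · rw [hψf z hzA, h.eq_zero z hz, mul_zero]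
    · rw [hχ.eq_zero _ fun hL => hzA (hχ.subset hL), zero_mul]

end Extension

/-! ### Topology of the groupoid and invariance of the Haar system -/

section Groupoid

variable {C : Type u} [Groupoid.{v} C]

namespace Arrows

/-- Inversion on the set of arrows. -/
def inv (x : Arrows C) : Arrows C := mk (Groupoid.inv x.hom)

@[simp]
theorem inv_inv (x : Arrows C) : x.inv.inv = x := by
  simp [inv]

/-- The product `y⁻¹ · x` for `r(y) = r(x)`. -/
def ldiv (y x : Arrows C) (h : y.cod = x.cod) : Arrows C :=
  mk (x.hom ≫ eqToHom h.symm ≫ Groupoid.inv y.hom)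

/-- The range of an arrow as a unit. -/
def unitCod (x : Arrows C) : UnitSpace C := ⟨x.cod⟩

/-- The domain of an arrow as a unit. -/
def unitDom (x : Arrows C) : UnitSpace C := ⟨x.dom⟩

end Arrows

/-- Inversion, from `Gᵘ` to `Gᵤ`. -/
def RangeFiber.inv {w : C} (y : RangeFiber w) : SourceFiber w := ⟨Groupoid.inv y.hom⟩

/-- Inversion, from `Gᵤ` to `Gᵘ`. -/
def SourceFiber.inv {w : C} (y : SourceFiber w) : RangeFiber w := ⟨Groupoid.inv y.hom⟩

@[simp]
theorem RangeFiber.inv_inv {w : C} (y : RangeFiber w) : y.inv.inv = y := by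
  simp [RangeFiber.inv, SourceFiber.inv]

@[simp]
theorem SourceFiber.inv_inv {w : C} (y : SourceFiber w) : y.inv.inv = y := by
  simp [RangeFiber.inv, SourceFiber.inv]

theorem RangeFiber.toArrow_injective {w : C} :
    Function.Injective (RangeFiber.toArrow : RangeFiber w → Arrows C) := by
  rintro ⟨f⟩ ⟨g⟩ h
  cases h
  rfl

theorem SourceFiber.toArrow_injective {w : C} :
    Function.Injective (SourceFiber.toArrow : SourceFiber w → Arrows C) := by
  rintro ⟨f⟩ ⟨g⟩ h
  cases h
  rfl

theorem RangeFiber.range_toArrow (w : C) :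
    Set.range (RangeFiber.toArrow : RangeFiber w → Arrows C) = Arrows.unitCod ⁻¹' {⟨w⟩} := by
  ext x
  constructor
  · rintro ⟨y, rfl⟩
    rfl
  · intro h
    obtain ⟨hom⟩ := x
    cases h
    exact ⟨⟨hom⟩, rfl⟩

theorem SourceFiber.range_toArrow (w : C) :
    Set.range (SourceFiber.toArrow : SourceFiber w → Arrows C) = Arrows.unitDom ⁻¹' {⟨w⟩} := by
  ext x
  constructor
  · rintro ⟨y, rfl⟩
    rfl
  · intro h
    obtain ⟨hom⟩ := x
    cases h
    exact ⟨⟨hom⟩, rfl⟩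

variable [TopologicalSpace (Arrows C)]

theorem RangeFiber.isEmbedding_toArrow (w : C) :
    IsEmbedding (RangeFiber.toArrow : RangeFiber w → Arrows C) :=
  ⟨⟨rfl⟩, RangeFiber.toArrow_injective⟩

theorem SourceFiber.isEmbedding_toArrow (w : C) :
    IsEmbedding (SourceFiber.toArrow : SourceFiber w → Arrows C) :=
  ⟨⟨rfl⟩, SourceFiber.toArrow_injective⟩

theorem RangeFiber.continuous_mk_hom (w : C) :
    Continuous fun y : RangeFiber w => Arrows.mk y.hom :=
  (RangeFiber.isEmbedding_toArrow w).continuous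

theorem SourceFiber.continuous_mk_hom (w : C) :
    Continuous fun y : SourceFiber w => Arrows.mk y.hom :=
  (SourceFiber.isEmbedding_toArrow w).continuous

theorem RangeFiber.continuous_iff {Z : Type*} [TopologicalSpace Z] {w : C} {f : Z → RangeFiber w} :
    Continuous f ↔ Continuous fun z => Arrows.mk (f z).hom :=
  (RangeFiber.isEmbedding_toArrow w).continuous_iff

theorem SourceFiber.continuous_iff {Z : Type*} [TopologicalSpace Z] {w : C}
    {f : Z → SourceFiber w} : Continuous f ↔ Continuous fun z => Arrows.mk (f z).hom :=
  (SourceFiber.isEmbedding_toArrow w).continuous_iff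

section Topological

variable [IsTopologicalGroupoid C]

theorem continuous_mk_comp {Z : Type*} [TopologicalSpace Z] {a b c : Z → C}
    (x : ∀ z, b z ⟶ c z) (y : ∀ z, a z ⟶ b z) (hx : Continuous fun z => Arrows.mk (x z))
    (hy : Continuous fun z => Arrows.mk (y z)) : Continuous fun z => Arrows.mk (y z ≫ x z) :=
  IsTopologicalGroupoid.continuous_mul.comp
    (g := fun p : ComposablePair C => Arrows.mk (p.y ≫ p.x)) (f := fun z => ⟨x z, y z⟩)
    (continuous_induced_rng.mpr (hx.prodMk hy))

theorem Arrows.continuous_inv : Continuous (Arrows.inv : Arrows C → Arrows C) :=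
  IsTopologicalGroupoid.continuous_inv

theorem continuous_mk_inv {Z : Type*} [TopologicalSpace Z] {a b : Z → C}
    (x : ∀ z, a z ⟶ b z) (hx : Continuous fun z => Arrows.mk (x z)) :
    Continuous fun z => Arrows.mk (Groupoid.inv (x z)) :=
  Arrows.continuous_inv.comp hx

/-- The unit at r(x) is the product x x⁻¹. -/
theorem Arrows.continuous_unitCod : Continuous (Arrows.unitCod : Arrows C → UnitSpace C) := by
  refine continuous_induced_rng.mpr ?_
  have := continuous_mk_comp (fun x : Arrows C => x.hom) (fun x => Groupoid.inv x.hom)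
    continuous_id Arrows.continuous_inv
  simpa [Function.comp_def, Arrows.unitCod] using this

theorem Arrows.continuous_unitDom : Continuous (Arrows.unitDom : Arrows C → UnitSpace C) :=
  Arrows.continuous_unitCod.comp Arrows.continuous_inv

theorem Arrows.continuous_ldiv : Continuous fun p : {p : Arrows C × Arrows C // p.1.cod = p.2.cod} =>
    Arrows.ldiv p.1.1 p.1.2 p.2 := by
  -- The transport along r(y) = r(x) disappears once arrows are bundled with their endpoints.
  have key : ∀ (y x : Arrows C) (h : y.cod = x.cod),
      Arrows.mk (eqToHom h.symm ≫ Groupoid.inv y.hom) = y.inv := by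
    rintro ⟨y⟩ ⟨x⟩ h
    cases h
    simp [Arrows.inv]
  refine continuous_mk_comp (fun p : {p : Arrows C × Arrows C // p.1.cod = p.2.cod} =>
    eqToHom p.2.symm ≫ Groupoid.inv p.1.1.hom) (fun p => p.1.2.hom) ?_
    (continuous_snd.comp continuous_subtype_val)
  refine Continuous.congr ?_ fun p => (key p.1.1 p.1.2 p.2).symm
  exact Arrows.continuous_inv.comp (continuous_fst.comp continuous_subtype_val)

/-- Inversion as a homeomorphism of `G`. -/
def Arrows.invHomeomorph : Arrows C ≃ₜ Arrows C where
  toFun := Arrows.inv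
  invFun := Arrows.inv
  left_inv := Arrows.inv_inv
  right_inv := Arrows.inv_inv
  continuous_toFun := Arrows.continuous_inv
  continuous_invFun := Arrows.continuous_inv

/-- Inversion as a homeomorphism from `Gᵘ` to `Gᵤ`. -/
def RangeFiber.invHomeomorph (w : C) : RangeFiber w ≃ₜ SourceFiber w where
  toFun := RangeFiber.inv
  invFun := SourceFiber.inv
  left_inv := RangeFiber.inv_inv
  right_inv := SourceFiber.inv_inv
  continuous_toFun := SourceFiber.continuous_iff.mpr
    (continuous_mk_inv _ (RangeFiber.continuous_mk_hom w))
  continuous_invFun := RangeFiber.continuous_iff.mpr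
    (continuous_mk_inv _ (SourceFiber.continuous_mk_hom w))

/-- Left multiplication by `x`, from `G^{d(x)}` to `G^{r(x)}`. -/
def RangeFiber.mulLeft {a b : C} (x : a ⟶ b) : RangeFiber a ≃ₜ RangeFiber b where
  toFun z := ⟨z.hom ≫ x⟩
  invFun z := ⟨z.hom ≫ Groupoid.inv x⟩
  left_inv z := by simp
  right_inv z := by simp
  continuous_toFun := RangeFiber.continuous_iff.mpr
    (continuous_mk_comp (fun _ => x) _ continuous_const (RangeFiber.continuous_mk_hom a))
  continuous_invFun := RangeFiber.continuous_iff.mpr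
    (continuous_mk_comp (fun _ => Groupoid.inv x) _ continuous_const
      (RangeFiber.continuous_mk_hom b))

/-- Right multiplication by `γ`, from `G_{r(γ)}` to `G_{d(γ)}`. -/
def SourceFiber.mulRight {a b : C} (γ : a ⟶ b) : SourceFiber b ≃ₜ SourceFiber a where
  toFun z := ⟨γ ≫ z.hom⟩
  invFun z := ⟨Groupoid.inv γ ≫ z.hom⟩
  left_inv z := by simp
  right_inv z := by simp
  continuous_toFun := SourceFiber.continuous_iff.mpr
    (continuous_mk_comp _ (fun _ => γ) (SourceFiber.continuous_mk_hom b) continuous_const)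
  continuous_invFun := SourceFiber.continuous_iff.mpr
    (continuous_mk_comp _ (fun _ => Groupoid.inv γ) (SourceFiber.continuous_mk_hom a)
      continuous_const)

theorem RangeFiber.isClosedEmbedding_toArrow [T2Space (UnitSpace C)] (w : C) :
    IsClosedEmbedding (RangeFiber.toArrow : RangeFiber w → Arrows C) :=
  ⟨RangeFiber.isEmbedding_toArrow w, by
    rw [RangeFiber.range_toArrow]
    exact isClosed_singleton.preimage Arrows.continuous_unitCod⟩

theorem SourceFiber.isClosedEmbedding_toArrow [T2Space (UnitSpace C)] (w : C) :
    IsClosedEmbedding (SourceFiber.toArrow : SourceFiber w → Arrows C) :=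
  ⟨SourceFiber.isEmbedding_toArrow w, by
    rw [SourceFiber.range_toArrow]
    exact isClosed_singleton.preimage Arrows.continuous_unitDom⟩

/-- The map `(x, t) ↦ x t⁻¹` on `Gᵥ × Gᵥ`. -/
theorem SourceFiber.continuous_div (w : C) : Continuous fun p : SourceFiber w × SourceFiber w =>
    Arrows.mk (Groupoid.inv p.2.hom ≫ p.1.hom) :=
  continuous_mk_comp (fun p : SourceFiber w × SourceFiber w => p.1.hom)
    (fun p => Groupoid.inv p.2.hom)
    ((SourceFiber.continuous_mk_hom w).comp continuous_fst)
    (continuous_mk_inv _ ((SourceFiber.continuous_mk_hom w).comp continuous_snd))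

end Topological

section LocallyCompact

variable [IsLocallyCompactGroupoid C]

instance unitSpace_t2Space : T2Space (UnitSpace C) := IsLocallyCompactGroupoid.unit_t2

instance rangeFiber_t2Space (w : C) : T2Space (RangeFiber w) := IsLocallyCompactGroupoid.fiber_t2 w

instance rangeFiber_locallyCompactSpace (w : C) : LocallyCompactSpace (RangeFiber w) :=
  IsLocallyCompactGroupoid.fiber_locallyCompact w

instance sourceFiber_t2Space (w : C) : T2Space (SourceFiber w) :=
  (RangeFiber.invHomeomorph w).symm.isEmbedding.t2Space

instance arrows_secondCountableTopology : SecondCountableTopology (Arrows C) := by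
  obtain ⟨K, hK, -, hb⟩ := IsLocallyCompactGroupoid.exists_countable_basis (C := C)
  exact hb.secondCountableTopology (hK.image _)

instance rangeFiber_secondCountableTopology (w : C) : SecondCountableTopology (RangeFiber w) :=
  (RangeFiber.isEmbedding_toArrow w).secondCountableTopology

instance sourceFiber_secondCountableTopology (w : C) : SecondCountableTopology (SourceFiber w) :=
  (SourceFiber.isEmbedding_toArrow w).secondCountableTopology

theorem Arrows.exists_isOpen_t2Space (x : Arrows C) : ∃ A, IsOpen A ∧ x ∈ A ∧ T2Space A := by
  obtain ⟨K, -, hK, hb⟩ := IsLocallyCompactGroupoid.exists_countable_basis (C := C)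
  obtain ⟨_, ⟨s, hs, rfl⟩, hx, -⟩ := hb.exists_subset_of_mem_open (Set.mem_univ x) isOpen_univ
  exact ⟨interior s, isOpen_interior, hx, t2Space_of_subset (hK s hs).2 interior_subset⟩

/-- Around x there is a compact Hausdorff set s from the given family; small compact neighbourhoods
exist in s and are neighbourhoods in G because x is interior to s. -/
instance arrows_locallyCompactSpace : LocallyCompactSpace (Arrows C) := by
  refine ⟨fun x n hn => ?_⟩
  obtain ⟨K, -, hK, hb⟩ := IsLocallyCompactGroupoid.exists_countable_basis (C := C)
  obtain ⟨_, ⟨s, hs, rfl⟩, hx, -⟩ := hb.exists_subset_of_mem_open (Set.mem_univ x) isOpen_univ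
  have := (hK s hs).2
  have : CompactSpace s := isCompact_iff_compactSpace.mp (hK s hs).1
  obtain ⟨k, hk, hkn, hkc⟩ := local_compact_nhds (x := (⟨x, interior_subset hx⟩ : s))
    (n := Subtype.val ⁻¹' (n ∩ interior s))
    (continuous_subtype_val.continuousAt.preimage_mem_nhds
      (Filter.inter_mem hn (isOpen_interior.mem_nhds hx)))
  refine ⟨Subtype.val '' k, ?_, ?_, hkc.image continuous_subtype_val⟩
  · rw [nhds_subtype_eq_comap, Filter.mem_comap] at hk
    obtain ⟨t, ht, htk⟩ := hk
    filter_upwards [ht, isOpen_interior.mem_nhds hx] with y hy hys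
    exact ⟨⟨y, interior_subset hys⟩, htk hy, rfl⟩
  · rintro _ ⟨y, hy, rfl⟩
    exact (hkn hy).1

theorem Cc_comp_rangeFiber {f : Arrows C → ℂ} (hf : f ∈ Cc (Arrows C)) (w : C) :
    Continuous (fun y : RangeFiber w => f y.toArrow) ∧
      HasCompactSupport (fun y : RangeFiber w => f y.toArrow) :=
  mem_Cc_iff_of_t2Space.mp (Cc_comp_isClosedEmbedding hf (RangeFiber.isClosedEmbedding_toArrow w))

theorem Cc_comp_sourceFiber {f : Arrows C → ℂ} (hf : f ∈ Cc (Arrows C)) (w : C) :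
    Continuous (fun y : SourceFiber w => f y.toArrow) ∧
      HasCompactSupport (fun y : SourceFiber w => f y.toArrow) :=
  mem_Cc_iff_of_t2Space.mp (Cc_comp_isClosedEmbedding hf (SourceFiber.isClosedEmbedding_toArrow w))

theorem Cc_comp_inv {f : Arrows C → ℂ} (hf : f ∈ Cc (Arrows C)) :
    (fun x => f x.inv) ∈ Cc (Arrows C) :=
  Cc_comp_isClosedEmbedding hf Arrows.invHomeomorph.isClosedEmbedding

theorem sourceFiber_measurable_div {f : Arrows C → ℂ} (hf : f ∈ Cc (Arrows C)) (w : C) :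
    Measurable (Function.uncurry fun x t : SourceFiber w =>
      f (Arrows.mk (Groupoid.inv t.hom ≫ x.hom))) := by
  let : MeasurableSpace (Arrows C) := borel _
  have : BorelSpace (Arrows C) := ⟨rfl⟩
  exact (Cc_measurable hf).comp (SourceFiber.continuous_div w).measurable

section Haar

variable {lam : ∀ w : C, Measure (RangeFiber w)}

theorem IsHaarSystem.integrable (h : IsHaarSystem lam) {f : Arrows C → ℂ} (hf : f ∈ Cc (Arrows C))
    (w : C) : Integrable (fun y : RangeFiber w => f y.toArrow) (lam w) :=
  have := h.regular w
  (Cc_comp_rangeFiber hf w).1.integrable_of_hasCompactSupport (Cc_comp_rangeFiber hf w).2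

theorem IsHaarSystem.sigmaFinite (h : IsHaarSystem lam) (w : C) : SigmaFinite (lam w) :=
  have := h.regular w
  inferInstance

omit [IsLocallyCompactGroupoid C] in
theorem rightMeasure_eq_map [IsTopologicalGroupoid C]
    (lam : ∀ w : C, Measure (RangeFiber w)) (w : C) :
    rightMeasure lam w = (lam w).map (RangeFiber.invHomeomorph w) := rfl

theorem IsHaarSystem.sigmaFinite_rightMeasure (h : IsHaarSystem lam) (w : C) :
    SigmaFinite (rightMeasure lam w) := by
  have := h.sigmaFinite w
  exact (RangeFiber.invHomeomorph w).toMeasurableEquiv.sigmaFinite_map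

/-- Left invariance is assumed only against C_c(G). The fibre is closed in G, so each of its
compactly supported continuous functions extends to C_c(G), and regular measures are determined by
such integrals. -/
theorem IsHaarSystem.map_mulLeft (h : IsHaarSystem lam) {a b : C} (x : a ⟶ b) :
    (lam a).map (RangeFiber.mulLeft x) = lam b := by
  have := h.regular a
  have := h.regular b
  have : ((lam a).map (RangeFiber.mulLeft x)).Regular := .map _
  refine Measure.ext_of_integral_eq_on_compactlySupported fun f => ?_
  obtain ⟨g, hg, hgf⟩ := exists_Cc_extension (Y := Arrows C) Arrows.exists_isOpen_t2Space
    (RangeFiber.isClosedEmbedding_toArrow b) (φ := fun y => (f y : ℂ))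
    (mem_Cc_iff_of_t2Space.mpr ⟨Complex.continuous_ofReal.comp f.continuous,
      f.hasCompactSupport.comp_left Complex.ofReal_zero⟩)
  have hgf' : ∀ y : RangeFiber b, g (Arrows.mk y.hom) = f y := fun y => congrFun hgf y
  have h2 := h.left_invariant x g hg
  apply Complex.ofReal_injective
  rw [← integral_complex_ofReal, ← integral_complex_ofReal,
    (RangeFiber.mulLeft x).measurableEmbedding.integral_map]
  calc _ = ∫ z : RangeFiber a, g (Arrows.mk (z.hom ≫ x)) ∂(lam a) :=
        integral_congr_ae (.of_forall fun z => (hgf' ⟨z.hom ≫ x⟩).symm)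
    _ = _ := by
        rw [h2]
        exact integral_congr_ae (.of_forall hgf')

/-- Under inversion, right multiplication by γ becomes left multiplication by γ⁻¹. -/
theorem IsHaarSystem.map_mulRight (h : IsHaarSystem lam) {a b : C} (γ : a ⟶ b) :
    (rightMeasure lam b).map (SourceFiber.mulRight γ) = rightMeasure lam a := by
  rw [rightMeasure_eq_map, rightMeasure_eq_map, ← h.map_mulLeft (Groupoid.inv γ),
    Measure.map_map (by fun_prop) (by fun_prop), Measure.map_map (by fun_prop) (by fun_prop)]
  congr 1
  ext z
  simp [RangeFiber.invHomeomorph, RangeFiber.mulLeft, SourceFiber.mulRight, RangeFiber.inv]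

end Haar

end LocallyCompact

end Groupoid

/-! ### Convolution on C_c(G) -/

/-- Substitute for closedness of compact sets: R is closed relative to the Hausdorff open set W. -/
theorem eventually_notMem_of_isCompact {Y : Type*} [TopologicalSpace Y] {W R : Set Y}
    (hW : IsOpen W) (hT : T2Space W) (hR : IsCompact R) (hRW : R ⊆ W) {p : Y} (hpW : p ∈ W)
    (hpR : p ∉ R) : ∀ᶠ q in 𝓝 p, q ∉ R := by
  have hK : IsCompact (Subtype.val ⁻¹' R : Set W) := by
    rw [IsInducing.subtypeVal.isCompact_preimage_iff (by simpa using hRW)]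
    exact hR
  filter_upwards [(hW.isOpenMap_subtype_val _ hK.isClosed.isOpen_compl).mem_nhds
    ⟨⟨p, hpW⟩, hpR, rfl⟩]
  rintro _ ⟨z, hz, rfl⟩
  exact hz

section Convolution

open scoped NNReal

variable {C : Type u} [Groupoid.{v} C] [TopologicalSpace (Arrows C)]

/-- The convolution product `(f * g)(x) = ∫ f(y) g(y⁻¹ x) dλ^{r(x)}(y)`. -/
def groupoidConv (lam : ∀ w : C, Measure (RangeFiber w)) (f g : Arrows C → ℂ) (x : Arrows C) : ℂ :=
  ∫ y : RangeFiber x.cod, f y.toArrow * g (Arrows.mk (x.hom ≫ Groupoid.inv y.hom)) ∂(lam x.cod)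

variable [IsLocallyCompactGroupoid C] {lam : ∀ w : C, Measure (RangeFiber w)}

/-- If f is continuous on one Hausdorff open set, then |f| is in C_c(G) and u ↦ ∫|f| dλᵘ is
continuous with compact support, hence bounded. General f are reached by the triangle inequality,
because |f| may leave C_c(G) when G is not Hausdorff. -/
theorem IsHaarSystem.exists_lintegral_le (h : IsHaarSystem lam) {f : Arrows C → ℂ}
    (hf : f ∈ Cc (Arrows C)) :
    ∃ M : ℝ≥0, ∀ w, ∫⁻ y : RangeFiber w, ‖f y.toArrow‖ₑ ∂(lam w) ≤ M := by
  -- Membership in C_c(G) is carried through the induction to supply measurability in the step for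
  -- sums.
  suffices f ∈ Cc (Arrows C) ∧ ∃ M : ℝ≥0, ∀ w, ∫⁻ y : RangeFiber w, ‖f y.toArrow‖ₑ ∂(lam w) ≤ M
    from this.2
  refine Cc_induction
    (p := fun f => f ∈ Cc (Arrows C) ∧
      ∃ M : ℝ≥0, ∀ w, ∫⁻ y : RangeFiber w, ‖f y.toArrow‖ₑ ∂(lam w) ≤ M)
    (f := f) hf ?_ ?_ ?_ ?_
  · intro f U K hf
    have hn := (hf.comp_left (φ := fun z => (‖z‖ : ℂ)) (by fun_prop) (by simp)).mem_Cc
    obtain ⟨h1, h2⟩ := mem_Cc_iff_of_t2Space.mp (h.continuous_integral _ hn)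
    obtain ⟨M, hM⟩ := h2.exists_bound_of_continuous h1
    refine ⟨hf.mem_Cc, M.toNNReal, fun w => ?_⟩
    have hint := h.integrable hf.mem_Cc w
    have hMw := hM ⟨w⟩
    rw [integral_complex_ofReal, Complex.norm_real, Real.norm_of_nonneg (by positivity)] at hMw
    rw [← ofReal_integral_norm_eq_lintegral_enorm hint]
    exact ENNReal.ofReal_le_ofReal hMw
  · exact ⟨zero_mem _, 0, fun w => by simp⟩
  · rintro f g ⟨hf, M, hM⟩ ⟨hg, N, hN⟩
    refine ⟨add_mem hf hg, M + N, fun w => ?_⟩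
    calc _ ≤ ∫⁻ y : RangeFiber w, ‖f y.toArrow‖ₑ + ‖g y.toArrow‖ₑ ∂(lam w) :=
          lintegral_mono fun y => enorm_add_le _ _
      _ ≤ _ := by
          rw [lintegral_add_left' (h.integrable hf w).1.enorm, ENNReal.coe_add]
          exact add_le_add (hM w) (hN w)
  · rintro c f ⟨hf, M, hM⟩
    refine ⟨Submodule.smul_mem _ c hf, ‖c‖₊ * M, fun w => ?_⟩
    simp only [Pi.smul_apply, enorm_smul]
    rw [lintegral_const_mul' _ _ (by simp), ENNReal.coe_mul]
    gcongr
    exacts [le_rfl, hM w]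

theorem Cc_comp_ldiv {g : Arrows C → ℂ} (hg : g ∈ Cc (Arrows C)) {a w : C} (x : a ⟶ w) :
    Continuous fun y : RangeFiber w => g (Arrows.mk (x ≫ Groupoid.inv y.hom)) := 
  (Cc_comp_sourceFiber hg a).1.comp ((SourceFiber.mulRight x).continuous.comp
    (RangeFiber.invHomeomorph w).continuous)

theorem IsHaarSystem.integrable_mul_ldiv (h : IsHaarSystem lam) {f g : Arrows C → ℂ}
    (hf : f ∈ Cc (Arrows C)) (hg : g ∈ Cc (Arrows C)) {a w : C} (x : a ⟶ w) :
    Integrable (fun y : RangeFiber w =>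
      f y.toArrow * g (Arrows.mk (x ≫ Groupoid.inv y.hom))) (lam w) :=
  have := h.regular w
  ((Cc_comp_rangeFiber hf w).1.mul (Cc_comp_ldiv hg x)).integrable_of_hasCompactSupport
    (Cc_comp_rangeFiber hf w).2.mul_right

theorem IsHaarSystem.convolution_add_left (h : IsHaarSystem lam) {f₁ f₂ g : Arrows C → ℂ}
    (hf₁ : f₁ ∈ Cc (Arrows C)) (hf₂ : f₂ ∈ Cc (Arrows C)) (hg : g ∈ Cc (Arrows C)) :
    groupoidConv lam (f₁ + f₂) g = groupoidConv lam f₁ g + groupoidConv lam f₂ g := by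
  ext x
  simp only [groupoidConv, Pi.add_apply, add_mul]
  exact integral_add (h.integrable_mul_ldiv hf₁ hg x.hom) (h.integrable_mul_ldiv hf₂ hg x.hom)

theorem IsHaarSystem.convolution_add_right (h : IsHaarSystem lam) {f g₁ g₂ : Arrows C → ℂ}
    (hf : f ∈ Cc (Arrows C)) (hg₁ : g₁ ∈ Cc (Arrows C)) (hg₂ : g₂ ∈ Cc (Arrows C)) :
    groupoidConv lam f (g₁ + g₂) = groupoidConv lam f g₁ + groupoidConv lam f g₂ := by
  ext x
  simp only [groupoidConv, Pi.add_apply, mul_add]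
  exact integral_add (h.integrable_mul_ldiv hf hg₁ x.hom) (h.integrable_mul_ldiv hf hg₂ x.hom)

omit [IsLocallyCompactGroupoid C] in
theorem convolution_smul_left (c : ℂ) (f g : Arrows C → ℂ) :
    groupoidConv lam (c • f) g = c • groupoidConv lam f g := by
  ext x
  simp only [groupoidConv, Pi.smul_apply, smul_eq_mul, mul_assoc, integral_const_mul]

omit [IsLocallyCompactGroupoid C] in
theorem convolution_smul_right (c : ℂ) (f g : Arrows C → ℂ) :
    groupoidConv lam f (c • g) = c • groupoidConv lam f g := by
  ext x
  simp only [groupoidConv, Pi.smul_apply, smul_eq_mul, mul_left_comm _ c, integral_const_mul]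

omit [IsLocallyCompactGroupoid C] in
-- The composable pairs are the locus d(x) = r(y), closed because the unit space is Hausdorff.
theorem ComposablePair.isClosedEmbedding [IsTopologicalGroupoid C] [T2Space (UnitSpace C)] :
    IsClosedEmbedding fun p : ComposablePair C => (Arrows.mk p.x, Arrows.mk p.y) := by
  refine ⟨⟨⟨rfl⟩, ?_⟩, ?_⟩
  · rintro ⟨x, y⟩ ⟨x', y'⟩ h
    cases h
    rfl
  · have : Set.range (fun p : ComposablePair C => (Arrows.mk p.x, Arrows.mk p.y)) =
        {p | p.1.unitDom = p.2.unitCod} := by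
      ext ⟨⟨x⟩, ⟨y⟩⟩
      constructor
      · rintro ⟨p, hp⟩
        cases hp
        rfl
      · intro h
        cases h
        exact ⟨⟨x, y⟩, rfl⟩
    rw [this]
    exact isClosed_eq (Arrows.continuous_unitDom.comp continuous_fst)
      (Arrows.continuous_unitCod.comp continuous_snd)

theorem isCompact_composablePair {K L : Set (Arrows C)} (hK : IsCompact K) (hL : IsCompact L) :
    IsCompact {p : ComposablePair C | Arrows.mk p.x ∈ K ∧ Arrows.mk p.y ∈ L} :=
  ComposablePair.isClosedEmbedding.isCompact_preimage (hK.prod hL)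

theorem Arrows.eventually_ldiv_mem {x₀ y₀ : Arrows C} (h₀ : y₀.cod = x₀.cod) {N : Set (Arrows C)}
    (hN : N ∈ 𝓝 (Arrows.ldiv y₀ x₀ h₀)) :
    ∀ᶠ p : Arrows C × Arrows C in 𝓝 (x₀, y₀), ∀ h : p.2.cod = p.1.cod,
      Arrows.ldiv p.2 p.1 h ∈ N := by
  have h1 := Arrows.continuous_ldiv.continuousAt (x := ⟨(y₀, x₀), h₀⟩) hN
  rw [Filter.mem_map, nhds_subtype_eq_comap, Filter.mem_comap] at h1
  obtain ⟨t, ht, htN⟩ := h1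
  have h2 := (continuous_swap.tendsto (x₀, y₀)).eventually ht
  filter_upwards [h2] with p hp h
  exact @htN ⟨(p.2, p.1), h⟩ hp

omit [TopologicalSpace (Arrows C)] [IsLocallyCompactGroupoid C] in
theorem Arrows.exists_composablePair_of_cod_eq {y x : Arrows C} (h : y.cod = x.cod) :
    ∃ p : ComposablePair C, Arrows.mk p.x = y ∧ Arrows.mk p.y = Arrows.ldiv y x h ∧
      Arrows.mk (p.y ≫ p.x) = x := by
  obtain ⟨y⟩ := y
  obtain ⟨x⟩ := x
  cases h
  exact ⟨⟨y, x ≫ Groupoid.inv y⟩, rfl, by simp [Arrows.ldiv], by simp⟩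

omit [TopologicalSpace (Arrows C)] [IsLocallyCompactGroupoid C] in
theorem Arrows.ldiv_toArrow (x : Arrows C) (y : RangeFiber x.cod) :
    Arrows.ldiv y.toArrow x rfl = Arrows.mk (x.hom ≫ Groupoid.inv y.hom) := by
  simp [Arrows.ldiv, RangeFiber.toArrow]

section Local

variable {f g : Arrows C → ℂ} {A D B K L : Set (Arrows C)}

/-- Uniform approximation of `y ↦ g(y⁻¹ x)` for `x` near `x₀` by an extension of
`y ↦ g(y⁻¹ x₀)`. -/
theorem eventually_norm_ldiv_sub_lt (hA : IsOpen A) (hAT : T2Space A) (hK : IsCompact K)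
    (hKA : K ⊆ A) (hg : IsCcOn g D L) (hB : IsOpen B) (hBT : T2Space B)
    (hADB : ∀ p : ComposablePair C, Arrows.mk p.x ∈ A → Arrows.mk p.y ∈ D →
      Arrows.mk (p.y ≫ p.x) ∈ B) {x₀ : Arrows C} (hx₀ : x₀ ∈ B) {ψ : Arrows C → ℂ}
    (hψ : ContinuousOn ψ A)
    (hψg : ∀ y ∈ A, ∀ h : y.cod = x₀.cod, ψ y = g (Arrows.ldiv y x₀ h)) {ε : ℝ} (hε : 0 < ε) :
    ∀ᶠ x in 𝓝 x₀, ∀ y ∈ K, ∀ h : y.cod = x.cod, ‖g (Arrows.ldiv y x h) - ψ y‖ < ε := by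
  suffices ∀ᶠ x in 𝓝 x₀, ∀ y ∈ K, (y ∈ K → ∀ h : y.cod = x.cod,
      ‖g (Arrows.ldiv y x h) - ψ y‖ < ε) from
    this.mono fun x hx y hy => hx y hy hy
  -- By compactness of K it suffices to work near each pair (x₀, y₀). Either y₀⁻¹x₀ lies in D, where
  -- g is continuous; or it lies outside D, where g has to be shown to vanish nearby; or the ranges
  -- differ, and then they differ for all nearby pairs.
  refine hK.eventually_forall_of_forall_eventually fun y₀ hy₀ => ?_
  by_cases h₀ : y₀.cod = x₀.cod
  · have hψ₀ : ∀ᶠ p : Arrows C × Arrows C in 𝓝 (x₀, y₀), ‖ψ p.2 - ψ y₀‖ < ε / 2 := by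
      have h1 := (hψ.continuousAt (hA.mem_nhds (hKA hy₀))).eventually
        (Metric.ball_mem_nhds (ψ y₀) (half_pos hε))
      filter_upwards [continuousAt_snd.eventually h1] with p hp
      simpa [dist_eq_norm] using hp
    have hg₀ : ∀ᶠ p : Arrows C × Arrows C in 𝓝 (x₀, y₀), p.2 ∈ K → ∀ h : p.2.cod = p.1.cod,
        ‖g (Arrows.ldiv p.2 p.1 h) - ψ y₀‖ < ε / 2 := by
      rw [hψg y₀ (hKA hy₀) h₀]
      by_cases hD : Arrows.ldiv y₀ x₀ h₀ ∈ D
      · have h1 := (hg.continuousOn.continuousAt (hg.isOpen.mem_nhds hD)).eventually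
          (Metric.ball_mem_nhds _ (half_pos hε))
        filter_upwards [Arrows.eventually_ldiv_mem h₀ h1] with p hp _ h
        simpa [dist_eq_norm] using hp h
      -- R consists of the pairs (x, y) with y ∈ K and y⁻¹x ∈ L. It is compact and lies in the
      -- Hausdorff open set B × A, so pairs near (x₀, y₀) avoid it, and g(y⁻¹x) = 0 for those with y
      -- ∈ K.
      · set R : Set (Arrows C × Arrows C) :=
          (fun p : ComposablePair C => (Arrows.mk (p.y ≫ p.x), Arrows.mk p.x)) ''
            {p | Arrows.mk p.x ∈ K ∧ Arrows.mk p.y ∈ L} with hR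
        have hRc : IsCompact R := by
          refine (isCompact_composablePair hK hg.isCompact).image ?_
          exact IsTopologicalGroupoid.continuous_mul.prodMk
            (continuous_fst.comp ComposablePair.isClosedEmbedding.continuous)
        have hRW : R ⊆ B ×ˢ A := by
          rintro _ ⟨p, ⟨h1, h2⟩, rfl⟩
          exact ⟨hADB p (hKA h1) (hg.subset h2), hKA h1⟩
        have hT : T2Space (B ×ˢ A : Set (Arrows C × Arrows C)) :=
          (Homeomorph.Set.prod B A).isEmbedding.t2Space
        have hnot : (x₀, y₀) ∉ R := by
          rintro ⟨p, ⟨h1, h2⟩, hp⟩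
          obtain ⟨x, y⟩ := p
          cases hp
          exact hD (hg.subset (by simpa [Arrows.ldiv] using h2))
        filter_upwards [eventually_notMem_of_isCompact (hB.prod hA) hT hRc hRW
          ⟨hx₀, hKA hy₀⟩ hnot] with p hp hpK h
        have hzero : g (Arrows.ldiv p.2 p.1 h) = 0 := by
          refine hg.eq_zero _ fun hL => hp ?_
          obtain ⟨q, h1, h2, h3⟩ := Arrows.exists_composablePair_of_cod_eq h
          exact ⟨q, ⟨h1 ▸ hpK, h2 ▸ hL⟩, Prod.ext h3 h1⟩
        rw [hzero, hg.eq_zero _ fun hL => hD (hg.subset hL), sub_zero, norm_zero]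
        exact half_pos hε
    filter_upwards [hψ₀, hg₀] with p h1 h2 hpK h
    calc _ = ‖(g (Arrows.ldiv p.2 p.1 h) - ψ y₀) - (ψ p.2 - ψ y₀)‖ := by congr 1; ring
      _ < ε := (norm_sub_le _ _).trans_lt (by linarith [h2 hpK h])
  · have hne : ∀ᶠ p : Arrows C × Arrows C in 𝓝 (x₀, y₀), ¬ p.2.unitCod = p.1.unitCod := by
      refine (isClosed_eq (Arrows.continuous_unitCod.comp continuous_snd)
        (Arrows.continuous_unitCod.comp continuous_fst)).isOpen_compl.mem_nhds ?_
      exact fun h => h₀ (congrArg UnitSpace.obj h)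
    filter_upwards [hne] with p hp _ h
    exact (hp (by simp [Arrows.unitCod, h])).elim

/-- For continuity at x₀, extend y ↦ g(y⁻¹x₀) from the fibre to a function ψ on A. Then fψ is in
C_c(G), so x ↦ ∫ fψ dλ^{r(x)} is continuous by the Haar property. Near x₀ it differs from f * g by
at most δ ∫|f| dλ^{r(x)}, with δ arbitrary. -/
theorem IsHaarSystem.isCcOn_convolution (hlam : IsHaarSystem lam) (hf : IsCcOn f A K)
    (hg : IsCcOn g D L) (hB : IsOpen B) (hBT : T2Space B)
    (hADB : ∀ p : ComposablePair C, Arrows.mk p.x ∈ A → Arrows.mk p.y ∈ D →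
      Arrows.mk (p.y ≫ p.x) ∈ B) :
    IsCcOn (groupoidConv lam f g) B ((fun p : ComposablePair C => Arrows.mk (p.y ≫ p.x)) ''
      {p | Arrows.mk p.x ∈ K ∧ Arrows.mk p.y ∈ L}) where
  isOpen := hB
  t2 := hBT
  isCompact := (isCompact_composablePair hf.isCompact hg.isCompact).image
    IsTopologicalGroupoid.continuous_mul
  subset := by
    rintro _ ⟨p, ⟨h1, h2⟩, rfl⟩
    exact hADB p (hf.subset h1) (hg.subset h2)
  eq_zero x hx := by
    refine integral_eq_zero_of_ae (.of_forall fun y => ?_)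
    by_contra hne
    obtain ⟨h1, h2⟩ := mul_ne_zero_iff.mp hne
    refine hx ⟨⟨y.hom, x.hom ≫ Groupoid.inv y.hom⟩, ⟨?_, ?_⟩, by simp⟩
    · exact not_not.mp fun h => h1 (hf.eq_zero _ h)
    · exact not_not.mp fun h => h2 (hg.eq_zero _ h)
  continuousOn := by
    intro x₀ hx₀
    refine ContinuousAt.continuousWithinAt ?_
    obtain ⟨ψ, hψ, hψg⟩ := exists_continuousOn_extension
      (RangeFiber.isClosedEmbedding_toArrow x₀.cod) hf.isOpen hf.t2
      (Cc_comp_ldiv hg.mem_Cc x₀.hom).continuousOn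
    have hψg' : ∀ y ∈ A, ∀ h : y.cod = x₀.cod, ψ y = g (Arrows.ldiv y x₀ h) := by
      rintro ⟨y⟩ hy h
      cases h
      exact (hψg ⟨y⟩ hy).trans (congrArg g (Arrows.ldiv_toArrow x₀ ⟨y⟩).symm)
    obtain ⟨M, hM⟩ := hlam.exists_lintegral_le hf.mem_Cc
    have hfψ := hf.mul_left hψ
    have hcont := (mem_Cc_iff_of_t2Space.mp (hlam.continuous_integral _ hfψ.mem_Cc)).1.comp
      Arrows.continuous_unitCod
    have hx₀eq : groupoidConv lam f g x₀ =
        ∫ y : RangeFiber x₀.cod, f y.toArrow * ψ y.toArrow ∂(lam x₀.cod) := by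
      refine integral_congr_ae (.of_forall fun y => ?_)
      by_cases hy : y.toArrow ∈ A
      · simp only [hψg y hy]
      · simp only [hf.eq_zero _ fun h => hy (hf.subset h), zero_mul]
    rw [Metric.continuousAt_iff']
    intro ε hε
    -- This δ satisfies δM < ε/2; M + 1 is used because M may be zero.
    have hδ : 0 < ε / (2 * (M + 1)) := by positivity
    filter_upwards [eventually_norm_ldiv_sub_lt hf.isOpen hf.t2 hf.isCompact hf.subset hg hB hBT
      hADB hx₀ hψ hψg' hδ, Metric.continuousAt_iff'.mp hcont.continuousAt (ε / 2) (half_pos hε)]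
      with x hx hx'
    have h1 : ‖groupoidConv lam f g x -
        ∫ y : RangeFiber x.cod, f y.toArrow * ψ y.toArrow ∂(lam x.cod)‖ ≤
        ε / (2 * (M + 1)) * M := by
      rw [groupoidConv, ← integral_sub (hlam.integrable_mul_ldiv hf.mem_Cc hg.mem_Cc x.hom)
        (hlam.integrable hfψ.mem_Cc x.cod)]
      calc _ ≤ ∫ y : RangeFiber x.cod, ε / (2 * (M + 1)) * ‖f y.toArrow‖ ∂(lam x.cod) := by
            refine norm_integral_le_of_norm_le
              ((hlam.integrable hf.mem_Cc x.cod).norm.const_mul _) (.of_forall fun y => ?_)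
            rw [← mul_sub, norm_mul, mul_comm]
            by_cases hy : y.toArrow ∈ K
            · gcongr
              have := hx y.toArrow hy rfl
              rw [Arrows.ldiv_toArrow] at this
              exact this.le
            · simp [hf.eq_zero _ hy]
        _ ≤ _ := by
            rw [integral_const_mul]
            gcongr
            have h2 := hM x.cod
            rw [← ofReal_integral_norm_eq_lintegral_enorm (hlam.integrable hf.mem_Cc x.cod),
              ENNReal.ofReal_le_iff_le_toReal (by simp)] at h2
            simpa using h2
    have h2 : ε / (2 * (M + 1)) * M < ε / 2 := by
      have : (0 : ℝ) ≤ M := M.2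
      rw [div_mul_eq_mul_div, div_lt_div_iff₀ (by positivity) (by positivity)]
      nlinarith
    rw [hx₀eq]
    refine (dist_triangle _ (∫ y : RangeFiber x.cod, f y.toArrow * ψ y.toArrow ∂(lam x.cod))
      _).trans_lt ?_
    rw [dist_eq_norm]
    have h3 : dist (∫ y : RangeFiber x.cod, f y.toArrow * ψ y.toArrow ∂(lam x.cod))
      (∫ y : RangeFiber x₀.cod, f y.toArrow * ψ y.toArrow ∂(lam x₀.cod)) < ε / 2 := hx'
    linarith

end Local

/-- For composable y and z this is continuity of multiplication. Otherwise d(y) and r(z) are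
separated in the Hausdorff unit space, no products arise, and B may be empty. -/
theorem exists_isOpen_mul_subset (y z : Arrows C) : ∃ A D B : Set (Arrows C), IsOpen A ∧ y ∈ A ∧
    IsOpen D ∧ z ∈ D ∧ IsOpen B ∧ T2Space B ∧ ∀ p : ComposablePair C, Arrows.mk p.x ∈ A →
      Arrows.mk p.y ∈ D → Arrows.mk (p.y ≫ p.x) ∈ B := by
  by_cases h : y.unitDom = z.unitCod
  · obtain ⟨y⟩ := y
    obtain ⟨z⟩ := z
    cases h
    obtain ⟨B, hB, hyz, hBT⟩ := Arrows.exists_isOpen_t2Space (Arrows.mk (z ≫ y))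
    obtain ⟨O, hO, hOB⟩ := isOpen_induced_iff.mp
      (hB.preimage (IsTopologicalGroupoid.continuous_mul (C := C)))
    have hmem : (Arrows.mk y, Arrows.mk z) ∈ O := by
      have : (⟨y, z⟩ : ComposablePair C) ∈
        (fun p : ComposablePair C => (Arrows.mk p.x, Arrows.mk p.y)) ⁻¹' O := by
        rw [hOB]
        exact hyz
      exact this
    obtain ⟨A, D, hA, hD, hyA, hzD, hAD⟩ := isOpen_prod_iff.mp hO _ _ hmem
    refine ⟨A, D, B, hA, hyA, hD, hzD, hB, hBT, fun p h1 h2 => ?_⟩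
    have : p ∈ (fun p : ComposablePair C => (Arrows.mk p.x, Arrows.mk p.y)) ⁻¹' O := hAD ⟨h1, h2⟩
    rw [hOB] at this
    exact this
  · obtain ⟨S, T, hS, hT, hyS, hzT, hST⟩ := t2_separation h
    refine ⟨_, _, ∅, hS.preimage Arrows.continuous_unitDom, hyS,
      hT.preimage Arrows.continuous_unitCod, hzT, isOpen_empty, inferInstance, fun p h1 h2 => ?_⟩
    exact (Set.disjoint_left.mp hST h1 h2).elim

/-- `C_c(G)` is closed under convolution. -/
theorem IsHaarSystem.convolution_mem_Cc (hlam : IsHaarSystem lam) {f g : Arrows C → ℂ}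
    (hf : f ∈ Cc (Arrows C)) (hg : g ∈ Cc (Arrows C)) : groupoidConv lam f g ∈ Cc (Arrows C) := by
  have key : ∀ (y : Arrows C), ∀ g ∈ Cc (Arrows C), ∃ O, IsOpen O ∧ y ∈ O ∧
      ∀ f U K, IsCcOn f U K → U ⊆ O → groupoidConv lam f g ∈ Cc (Arrows C) := by
    intro y
    let T : Submodule ℂ (Arrows C → ℂ) :=
      { carrier := {g | g ∈ Cc (Arrows C) ∧ ∃ O, IsOpen O ∧ y ∈ O ∧
          ∀ f U K, IsCcOn f U K → U ⊆ O → groupoidConv lam f g ∈ Cc (Arrows C)}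
        add_mem' := by
          rintro g₁ g₂ ⟨hg₁, O₁, hO₁, hy₁, h₁⟩ ⟨hg₂, O₂, hO₂, hy₂, h₂⟩
          refine ⟨add_mem hg₁ hg₂, O₁ ∩ O₂, hO₁.inter hO₂, ⟨hy₁, hy₂⟩, fun f U K hf hU => ?_⟩
          rw [hlam.convolution_add_right hf.mem_Cc hg₁ hg₂]
          exact add_mem (h₁ f U K hf (hU.trans Set.inter_subset_left))
            (h₂ f U K hf (hU.trans Set.inter_subset_right))
        zero_mem' := by
          refine ⟨zero_mem _, Set.univ, isOpen_univ, trivial, fun f U K hf _ => ?_⟩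
          rw [← zero_smul ℂ (0 : Arrows C → ℂ), convolution_smul_right, zero_smul]
          exact zero_mem _
        smul_mem' := by
          rintro c g ⟨hg, O, hO, hy, h⟩
          refine ⟨Submodule.smul_mem _ c hg, O, hO, hy, fun f U K hf hU => ?_⟩
          rw [convolution_smul_right]
          exact Submodule.smul_mem _ c (h f U K hf hU) }
    suffices h : Cc (Arrows C) ≤ T from fun g hg => (h hg).2
    refine Cc_le_of_local T fun z => ?_
    obtain ⟨A, D, B, hA, hyA, hD, hzD, hB, hBT, hADB⟩ := exists_isOpen_mul_subset y z
    refine ⟨D, hD, hzD, fun g V L hg hV => ⟨hg.mem_Cc, A, hA, hyA, fun f U K hf hU => ?_⟩⟩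
    exact (hlam.isCcOn_convolution hf hg hB hBT fun p h1 h2 => hADB p (hU h1) (hV h2)).mem_Cc
  let S : Submodule ℂ (Arrows C → ℂ) :=
    { carrier := {f | f ∈ Cc (Arrows C) ∧ groupoidConv lam f g ∈ Cc (Arrows C)}
      add_mem' := by
        rintro f₁ f₂ ⟨hf₁, h₁⟩ ⟨hf₂, h₂⟩
        refine ⟨add_mem hf₁ hf₂, ?_⟩
        rw [hlam.convolution_add_left hf₁ hf₂ hg]
        exact add_mem h₁ h₂
      zero_mem' := by
        refine ⟨zero_mem _, ?_⟩
        rw [← zero_smul ℂ (0 : Arrows C → ℂ), convolution_smul_left, zero_smul]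
        exact zero_mem _
      smul_mem' := by
        rintro c f ⟨hf, h⟩
        refine ⟨Submodule.smul_mem _ c hf, ?_⟩
        rw [convolution_smul_left]
        exact Submodule.smul_mem _ c h }
  suffices h : Cc (Arrows C) ≤ S from (h hf).2
  refine Cc_le_of_local S fun y => ?_
  obtain ⟨O, hO, hy, h⟩ := key y g hg
  exact ⟨O, hO, hy, fun f U K hf hU => ⟨hf.mem_Cc, h f U K hf hU⟩⟩

end Convolution

/-! ### The regular representation -/

section RegularOperator

open scoped NNReal

variable {C : Type u} [Groupoid.{v} C] [TopologicalSpace (Arrows C)]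

/-- The kernel `(x, t) ↦ f(x t⁻¹)` on `Gᵥ × Gᵥ`. -/
def regularKernel (f : Arrows C → ℂ) (w : C) (x t : SourceFiber w) : ℂ :=
  f (Arrows.mk (Groupoid.inv t.hom ≫ x.hom))

/-- The involution `f⋆(x) = conj f(x⁻¹)`. -/
def groupoidStar (f : Arrows C → ℂ) (x : Arrows C) : ℂ := star (f x.inv)

omit [TopologicalSpace (Arrows C)] in
theorem star_regularKernel (f : Arrows C → ℂ) (w : C) (x t : SourceFiber w) :
    star (regularKernel f w t x) = regularKernel (groupoidStar f) w x t := by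
  simp [regularKernel, groupoidStar, Arrows.inv]

theorem IsRegularOperator.eq {lam : ∀ w : C, Measure (RangeFiber w)} {f : Arrows C → ℂ}
    {T T' : RegularRepSpace lam →L[ℂ] RegularRepSpace lam} (h : IsRegularOperator lam f T)
    (h' : IsRegularOperator lam f T') : T = T' := by
  ext ξ w
  filter_upwards [h ξ w, h' ξ w] with x hx hx'
  rw [hx, hx']

theorem IsRegularOperator.smul {lam : ∀ w : C, Measure (RangeFiber w)} {f : Arrows C → ℂ}
    {T : RegularRepSpace lam →L[ℂ] RegularRepSpace lam} (h : IsRegularOperator lam f T) (c : ℂ) :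
    IsRegularOperator lam (c • f) (c • T) := by
  intro ξ w
  filter_upwards [h ξ w, Lp.coeFn_smul c (T ξ w)] with x hx hx'
  refine hx'.trans ?_
  rw [Pi.smul_apply, hx, smul_eq_mul, ← integral_const_mul]
  simp only [Pi.smul_apply, smul_eq_mul, mul_assoc]

theorem IsRegularOperator.zero (lam : ∀ w : C, Measure (RangeFiber w)) :
    IsRegularOperator lam 0 0 := by
  intro ξ w
  filter_upwards [Lp.coeFn_zero ℂ 2 (rightMeasure lam w)] with x hx
  refine hx.trans ?_
  simp

variable [IsLocallyCompactGroupoid C] {lam : ∀ w : C, Measure (RangeFiber w)} {f g : Arrows C → ℂ}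

namespace IsHaarSystem

theorem Cc_groupoidStar (hf : f ∈ Cc (Arrows C)) : groupoidStar f ∈ Cc (Arrows C) :=
  Cc_comp_left_star (Cc_comp_inv hf)

variable (hlam : IsHaarSystem lam)
include hlam

theorem sfinite_rightMeasure (w : C) : SFinite (rightMeasure lam w) :=
  have := hlam.sigmaFinite_rightMeasure w
  inferInstance

/-- Substitute y = x t⁻¹; left invariance carries λ_w to λ^{r(x)}. -/
theorem lintegral_regularKernel {w : C} (x : SourceFiber w) :
    ∫⁻ t, ‖regularKernel f w x t‖ₑ ∂(rightMeasure lam w) =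
      ∫⁻ y : RangeFiber x.cod, ‖f y.toArrow‖ₑ ∂(lam x.cod) := by
  rw [← hlam.map_mulLeft x.hom, rightMeasure_eq_map,
    (RangeFiber.invHomeomorph w).measurableEmbedding.lintegral_map,
    (RangeFiber.mulLeft x.hom).measurableEmbedding.lintegral_map]
  refine lintegral_congr fun z => ?_
  simp [regularKernel, RangeFiber.invHomeomorph, RangeFiber.mulLeft, RangeFiber.toArrow,
    RangeFiber.inv]

/-- Rows are controlled by the L¹ bound for f, and columns by the one for f⋆, since the columns of f
are the conjugated rows of f⋆. -/
theorem exists_isSchurKernel (hf : f ∈ Cc (Arrows C)) :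
    ∃ M : ℝ≥0, ∀ w, IsSchurKernel (rightMeasure lam w) (regularKernel f w) M := by
  obtain ⟨M, hM⟩ := hlam.exists_lintegral_le hf
  obtain ⟨N, hN⟩ := hlam.exists_lintegral_le (Cc_groupoidStar hf)
  refine ⟨max M N, fun w => ⟨sourceFiber_measurable_div hf w, fun x => ?_, fun t => ?_⟩⟩
  · rw [hlam.lintegral_regularKernel]
    exact (hM _).trans (by simp)
  · calc _ = ∫⁻ x, ‖regularKernel (groupoidStar f) w t x‖ₑ ∂(rightMeasure lam w) := by
          simp [← star_regularKernel]
      _ ≤ _ := by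
          rw [hlam.lintegral_regularKernel]
          exact (hN _).trans (by simp)

theorem exists_isRegularOperator (hf : f ∈ Cc (Arrows C)) : ∃ T, IsRegularOperator lam f T := by
  obtain ⟨M, hM⟩ := hlam.exists_isSchurKernel hf
  have := hlam.sfinite_rightMeasure
  exact ⟨lpDiag (σ := id) Function.injective_id (fun w => (hM w).toCLM) M
    (fun w => (hM w).norm_toCLM_le), fun ξ w => (hM w).toCLM_ae (ξ w)⟩

omit [IsLocallyCompactGroupoid C] hlam in
theorem _root_.IsRegularOperator.apply_eq_toCLM {T : RegularRepSpace lam →L[ℂ] RegularRepSpace lam}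
    (hT : IsRegularOperator lam f T) {M : ℝ≥0} {w : C} [SFinite (rightMeasure lam w)]
    (hM : IsSchurKernel (rightMeasure lam w) (regularKernel f w) M) (ξ : RegularRepSpace lam) :
    T ξ w = hM.toCLM (ξ w) := by
  apply Lp.ext
  filter_upwards [hT ξ w, hM.toCLM_ae (ξ w)] with x hx hx'
  rw [hx, hx']
  rfl

theorem isRegularOperator_adjoint {T T' : RegularRepSpace lam →L[ℂ] RegularRepSpace lam}
    (hf : f ∈ Cc (Arrows C)) (hT : IsRegularOperator lam f T)
    (hT' : IsRegularOperator lam (groupoidStar f) T') : star T = T' := by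
  obtain ⟨M, hM⟩ := hlam.exists_isSchurKernel hf
  have := hlam.sfinite_rightMeasure
  rw [ContinuousLinearMap.star_eq_adjoint, eq_comm, ContinuousLinearMap.eq_adjoint_iff]
  intro ξ η
  rw [lp.inner_eq_tsum, lp.inner_eq_tsum]
  refine tsum_congr fun w => ?_
  have h1 : T' ξ w = (hM w).conj_swap.toCLM (ξ w) := by
    apply Lp.ext
    filter_upwards [hT' ξ w, (hM w).conj_swap.toCLM_ae (ξ w)] with x hx hx'
    rw [hx, hx']
    simp only [star_regularKernel]
    rfl
  rw [h1, hT.apply_eq_toCLM (hM w), ← inner_conj_symm, ← (hM w).inner_toCLM,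
    inner_conj_symm]

theorem isRegularOperator_add {S T : RegularRepSpace lam →L[ℂ] RegularRepSpace lam}
    (hf : f ∈ Cc (Arrows C)) (hg : g ∈ Cc (Arrows C)) (hS : IsRegularOperator lam f S)
    (hT : IsRegularOperator lam g T) : IsRegularOperator lam (f + g) (S + T) := by
  obtain ⟨M, hM⟩ := hlam.exists_isSchurKernel hf
  obtain ⟨N, hN⟩ := hlam.exists_isSchurKernel hg
  have := hlam.sfinite_rightMeasure
  intro ξ w
  filter_upwards [hS ξ w, hT ξ w, Lp.coeFn_add (S ξ w) (T ξ w), (hM w).ae_integrable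
    (Lp.memLp (ξ w)), (hN w).ae_integrable (Lp.memLp (ξ w))] with x h1 h2 h3 h4 h5
  refine h3.trans ?_
  rw [Pi.add_apply, h1, h2]
  exact (integral_add h4 h5).symm.trans
    (integral_congr_ae (.of_forall fun t => (add_mul _ _ _).symm))

/-- Substituting y = x s⁻¹ turns composition of kernels into convolution. -/
theorem integral_regularKernel_mul {w : C} (x t : SourceFiber w) :
    ∫ s, regularKernel f w x s * regularKernel g w s t ∂(rightMeasure lam w) =
      regularKernel (groupoidConv lam f g) w x t := by
  rw [regularKernel, groupoidConv, ← hlam.map_mulLeft x.hom, rightMeasure_eq_map,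
    (RangeFiber.invHomeomorph w).measurableEmbedding.integral_map,
    (RangeFiber.mulLeft x.hom).measurableEmbedding.integral_map]
  refine integral_congr_ae (.of_forall fun z => ?_)
  simp [regularKernel, RangeFiber.invHomeomorph, RangeFiber.mulLeft, RangeFiber.toArrow,
    RangeFiber.inv]

theorem isRegularOperator_mul {S T : RegularRepSpace lam →L[ℂ] RegularRepSpace lam}
    (hf : f ∈ Cc (Arrows C)) (hg : g ∈ Cc (Arrows C)) (hS : IsRegularOperator lam f S)
    (hT : IsRegularOperator lam g T) : IsRegularOperator lam (groupoidConv lam f g) (S * T) := by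
  obtain ⟨M, hM⟩ := hlam.exists_isSchurKernel hf
  obtain ⟨N, hN⟩ := hlam.exists_isSchurKernel hg
  have := hlam.sfinite_rightMeasure
  intro ξ w
  filter_upwards [hS (T ξ) w, (hM w).ae_integral_mul_integral (hN w) (Lp.memLp (ξ w))] with x h1 h2
  refine h1.trans (Eq.trans ?_ (h2.trans ?_))
  · refine integral_congr_ae ?_
    filter_upwards [hT ξ w] with s hs
    rw [hs]
    rfl
  · simp only [hlam.integral_regularKernel_mul]
    rfl

/-- The operators `⨁ᵥ Ind v (f)`, `f ∈ C_c(G)`, form a `⋆`-algebra. -/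
theorem adjoin_isRegularOperator_subset :
    (NonUnitalStarAlgebra.adjoin ℂ {T | ∃ f ∈ Cc (Arrows C), IsRegularOperator lam f T} :
      Set (RegularRepSpace lam →L[ℂ] RegularRepSpace lam)) ⊆
      {T | ∃ f ∈ Cc (Arrows C), IsRegularOperator lam f T} := by
  let A : NonUnitalStarSubalgebra ℂ (RegularRepSpace lam →L[ℂ] RegularRepSpace lam) :=
    { carrier := {T | ∃ f ∈ Cc (Arrows C), IsRegularOperator lam f T}
      add_mem' := by
        rintro S T ⟨f, hf, hS⟩ ⟨g, hg, hT⟩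
        exact ⟨f + g, add_mem hf hg, hlam.isRegularOperator_add hf hg hS hT⟩
      zero_mem' := ⟨0, zero_mem _, .zero lam⟩
      mul_mem' := by
        rintro S T ⟨f, hf, hS⟩ ⟨g, hg, hT⟩
        exact ⟨_, hlam.convolution_mem_Cc hf hg, hlam.isRegularOperator_mul hf hg hS hT⟩
      smul_mem' := by
        rintro c T ⟨f, hf, hT⟩
        exact ⟨_, Submodule.smul_mem _ c hf, hT.smul c⟩
      star_mem' := by
        rintro T ⟨f, hf, hT⟩
        obtain ⟨T', hT'⟩ := hlam.exists_isRegularOperator (Cc_groupoidStar hf)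
        exact ⟨_, Cc_groupoidStar hf, by
          rw [hlam.isRegularOperator_adjoint hf hT hT']
          exact hT'⟩ }
  exact NonUnitalStarAlgebra.adjoin_le (S := A) subset_rfl

/-- Compression is not multiplicative on all of C⋆ᵣ(G), so knowing it on generators would not
suffice; here every element is a limit of operators [f]_G themselves. -/
theorem reducedSubalgebra_subset_closure :
    (reducedSubalgebra lam : Set (RegularRepSpace lam →L[ℂ] RegularRepSpace lam)) ⊆
      closure {T | ∃ f ∈ Cc (Arrows C), IsRegularOperator lam f T} :=
  closure_mono hlam.adjoin_isRegularOperator_subset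

end IsHaarSystem

theorem mem_reducedSubalgebra_of_isRegularOperator {C : Type u} [Groupoid.{v} C]
    [TopologicalSpace (Arrows C)] {lam : ∀ w : C, Measure (RangeFiber w)} {f : Arrows C → ℂ}
    (hf : f ∈ Cc (Arrows C)) {T : RegularRepSpace lam →L[ℂ] RegularRepSpace lam}
    (hT : IsRegularOperator lam f T) : T ∈ reducedSubalgebra lam :=
  NonUnitalStarSubalgebra.le_topologicalClosure _
    (NonUnitalStarAlgebra.subset_adjoin ℂ _ ⟨f, hf, hT⟩)

end RegularOperator

/-! ### Clopen subgroupoids and their Haar systems -/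

section SubgroupoidTopology

variable {C : Type u} [Groupoid.{v} C]

/-- The inclusion of `Hᵤ` in `Gᵤ`, for a unit `u` of `H`. -/
def inclSource (H : Subgroupoid C) (w : H.objs) (y : SourceFiber w) : SourceFiber (w : C) :=
  SourceFiber.mk (H.hom.map y.hom)

theorem inclArrows_injective (H : Subgroupoid C) : Function.Injective (inclArrows H) := by
  rintro @⟨⟨a, ha⟩, ⟨b, hb⟩, ⟨x, hx⟩⟩ @⟨⟨c, hc⟩, ⟨d, hd⟩, ⟨y, hy⟩⟩ h
  cases h
  rfl

theorem range_inclArrows (H : Subgroupoid C) : Set.range (inclArrows H) = arrowSet H := by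
  ext x
  constructor
  · rintro ⟨y, rfl⟩
    exact y.hom.2
  · obtain ⟨x⟩ := x
    intro h
    exact ⟨Arrows.mk (dom := ⟨_, H.mem_objs_of_src h⟩) (cod := ⟨_, H.mem_objs_of_tgt h⟩) ⟨x, h⟩, rfl⟩

theorem range_inclFiber (H : Subgroupoid C) (w : H.objs) :
    Set.range (inclFiber H w) = RangeFiber.toArrow ⁻¹' arrowSet H := by
  ext y
  constructor
  · rintro ⟨z, rfl⟩
    exact z.hom.2
  · obtain ⟨y⟩ := y
    intro h
    exact ⟨RangeFiber.mk (dom := ⟨_, H.mem_objs_of_src h⟩) ⟨y, h⟩, rfl⟩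

theorem range_inclSource (H : Subgroupoid C) (w : H.objs) :
    Set.range (inclSource H w) = SourceFiber.toArrow ⁻¹' arrowSet H := by
  ext y
  constructor
  · rintro ⟨z, rfl⟩
    exact z.hom.2
  · obtain ⟨y⟩ := y
    intro h
    exact ⟨SourceFiber.mk (cod := ⟨_, H.mem_objs_of_tgt h⟩) ⟨y, h⟩, rfl⟩

variable [TopologicalSpace (Arrows C)]

theorem isEmbedding_inclArrows (H : Subgroupoid C) : IsEmbedding (inclArrows H) :=
  ⟨⟨rfl⟩, inclArrows_injective H⟩

theorem isEmbedding_inclFiber (H : Subgroupoid C) (w : H.objs) : IsEmbedding (inclFiber H w) :=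
  (IsEmbedding.of_comp_iff (RangeFiber.isEmbedding_toArrow (w : C))).mp
    ((isEmbedding_inclArrows H).comp (RangeFiber.isEmbedding_toArrow w))

theorem isEmbedding_inclSource (H : Subgroupoid C) (w : H.objs) : IsEmbedding (inclSource H w) :=
  (IsEmbedding.of_comp_iff (SourceFiber.isEmbedding_toArrow (w : C))).mp
    ((isEmbedding_inclArrows H).comp (SourceFiber.isEmbedding_toArrow w))

variable {H : Subgroupoid C} (hH : IsClopen (arrowSet H))
include hH

theorem isOpenEmbedding_inclArrows : IsOpenEmbedding (inclArrows H) :=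
  ⟨isEmbedding_inclArrows H, by rw [range_inclArrows]; exact hH.isOpen⟩

theorem isClosedEmbedding_inclArrows : IsClosedEmbedding (inclArrows H) :=
  ⟨isEmbedding_inclArrows H, by rw [range_inclArrows]; exact hH.isClosed⟩

theorem isOpenEmbedding_inclFiber (w : H.objs) : IsOpenEmbedding (inclFiber H w) :=
  ⟨isEmbedding_inclFiber H w, by
    rw [range_inclFiber]
    exact hH.isOpen.preimage (RangeFiber.isEmbedding_toArrow (w : C)).continuous⟩

theorem isOpenEmbedding_inclSource (w : H.objs) : IsOpenEmbedding (inclSource H w) :=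
  ⟨isEmbedding_inclSource H w, by
    rw [range_inclSource]
    exact hH.isOpen.preimage (SourceFiber.isEmbedding_toArrow (w : C)).continuous⟩

theorem restrictFun_mem_Cc {f : Arrows C → ℂ} (hf : f ∈ Cc (Arrows C)) :
    restrictFun H f ∈ Cc (Arrows H.objs) :=
  Cc_comp_isClosedEmbedding hf (isClosedEmbedding_inclArrows hH)

theorem extendByZero_mem_Cc {f : Arrows H.objs → ℂ} (hf : f ∈ Cc (Arrows H.objs)) :
    extendByZero H f ∈ Cc (Arrows C) :=
  Cc_extend_isOpenEmbedding hf (isOpenEmbedding_inclArrows hH)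

omit hH [TopologicalSpace (Arrows C)] in
theorem restrictFun_extendByZero (f : Arrows H.objs → ℂ) :
    restrictFun H (extendByZero H f) = f :=
  Function.extend_comp (inclArrows_injective H) f 0

omit hH [TopologicalSpace (Arrows C)] in
theorem extendByZero_of_notMem (f : Arrows H.objs → ℂ) {x : Arrows C} (hx : x ∉ arrowSet H) :
    extendByZero H f x = 0 :=
  Function.extend_apply' _ _ _ fun ⟨y, hy⟩ => hx (by rw [← range_inclArrows]; exact ⟨y, hy⟩)

omit hH [TopologicalSpace (Arrows C)] in
theorem inv_mem_arrowSet_iff {x : Arrows C} : x.inv ∈ arrowSet H ↔ x ∈ arrowSet H :=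
  H.inv_mem_iff x.hom

omit hH in
-- Continuity is inherited from the fibres of G, so H itself need not be known to be a topological
-- groupoid.
theorem continuous_inv_subgroupoid [IsTopologicalGroupoid C] (w : H.objs) :
    Continuous (RangeFiber.inv : RangeFiber w → SourceFiber w) := by
  rw [(isEmbedding_inclSource H w).continuous_iff]
  exact (RangeFiber.invHomeomorph (w : C)).continuous.comp (isEmbedding_inclFiber H w).continuous

/-- The right Haar system of `H` is the restriction of that of `G`. -/
theorem map_inclSource_rightMeasure [IsTopologicalGroupoid C]
    (lam : ∀ w : C, Measure (RangeFiber w)) (w : H.objs) :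
    (rightMeasure (restrictHaar H lam) w).map (inclSource H w) =
      (rightMeasure lam w).restrict (Set.range (inclSource H w)) := by
  have h1 := (isOpenEmbedding_inclFiber hH w).measurableEmbedding
  have h2 := (isOpenEmbedding_inclSource hH w).measurableEmbedding
  have hinv : rightMeasure (restrictHaar H lam) w = (restrictHaar H lam w).map RangeFiber.inv := rfl
  rw [hinv, Measure.map_map h2.measurable (continuous_inv_subgroupoid w).measurable,
    rightMeasure_eq_map, Measure.restrict_map (RangeFiber.invHomeomorph (w : C)).measurable
      h2.measurableSet_range]
  have hpre : RangeFiber.invHomeomorph (w : C) ⁻¹' Set.range (inclSource H w) =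
      Set.range (inclFiber H w) := by
    rw [range_inclSource, range_inclFiber]
    ext y
    exact inv_mem_arrowSet_iff (x := y.toArrow)
  rw [hpre, ← h1.map_comap, Measure.map_map (RangeFiber.invHomeomorph (w : C)).measurable
    h1.measurable]
  rfl

end SubgroupoidTopology

/-! ### Cosets of H in the fibres of G -/

section Translation

variable {C : Type u} [Groupoid.{v} C] {H : Subgroupoid C}

/-- The map `h ↦ h γ` from `H_w` to `G_v`, for `γ ∈ G_v` with range `w`. -/
def fiberTranslate {v : C} {w : H.objs} (γ : v ⟶ (w : C)) (h : SourceFiber w) : SourceFiber v :=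
  ⟨γ ≫ H.hom.map h.hom⟩

theorem mem_range_fiberTranslate {v : C} {w : H.objs} (γ : v ⟶ (w : C)) (x : SourceFiber v) :
    x ∈ Set.range (fiberTranslate γ) ↔ Groupoid.inv γ ≫ x.hom ∈ H.arrows w x.cod := by
  constructor
  · rintro ⟨h, rfl⟩
    change Groupoid.inv γ ≫ γ ≫ h.hom.1 ∈ H.arrows w h.cod
    rw [← Category.assoc, Groupoid.inv_comp, Category.id_comp]
    exact h.hom.2
  · obtain ⟨x⟩ := x
    intro h
    refine ⟨SourceFiber.mk (cod := ⟨_, H.mem_objs_of_tgt h⟩) ⟨_, h⟩, ?_⟩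
    simp [fiberTranslate, Subgroupoid.hom]

variable [TopologicalSpace (Arrows C)] [IsLocallyCompactGroupoid C]
  {lam : ∀ w : C, Measure (RangeFiber w)} (hlam : IsHaarSystem lam) (hH : IsClopen (arrowSet H))

include hH in
theorem isOpenEmbedding_fiberTranslate {v : C} {w : H.objs} (γ : v ⟶ (w : C)) :
    IsOpenEmbedding (fiberTranslate γ) :=
  (SourceFiber.mulRight γ).isOpenEmbedding.comp (isOpenEmbedding_inclSource hH w)

include hlam hH

/-- Factor the map as the inclusion of H_w in G_w, which identifies λ_H with a restriction of λ,
followed by right multiplication by γ, which preserves the right Haar system. -/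
theorem measurePreserving_fiberTranslate {v : C} {w : H.objs} (γ : v ⟶ (w : C)) :
    MeasurePreserving (fiberTranslate γ) (rightMeasure (restrictHaar H lam) w)
      ((rightMeasure lam v).restrict (Set.range (fiberTranslate γ))) := by
  refine ⟨(isOpenEmbedding_fiberTranslate hH γ).continuous.measurable, ?_⟩
  have h1 : fiberTranslate γ = SourceFiber.mulRight γ ∘ inclSource H w := rfl
  have h2 := (isOpenEmbedding_inclSource hH w).measurableEmbedding
  have h3 := (isOpenEmbedding_fiberTranslate hH γ).measurableEmbedding
  rw [← hlam.map_mulRight γ, Measure.restrict_map (SourceFiber.mulRight γ).measurable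
    h3.measurableSet_range, h1, ← Measure.map_map (SourceFiber.mulRight γ).measurable h2.measurable,
    map_inclSource_rightMeasure hH, Set.range_comp,
    Set.preimage_image_eq _ (SourceFiber.mulRight γ).injective]

theorem ae_fiberTranslate {v : C} {w : H.objs} (γ : v ⟶ (w : C)) {p : SourceFiber v → Prop}
    (h : ∀ᵐ x ∂(rightMeasure lam v), p x) :
    ∀ᵐ y ∂(rightMeasure (restrictHaar H lam) w), p (fiberTranslate γ y) :=
  (measurePreserving_fiberTranslate hlam hH γ).quasiMeasurePreserving.ae (ae_restrict_of_ae h)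

theorem integral_fiberTranslate {v : C} {w : H.objs} (γ : v ⟶ (w : C)) {F : SourceFiber v → ℂ}
    (hF : ∀ᵐ x ∂(rightMeasure lam v), x ∉ Set.range (fiberTranslate γ) → F x = 0) :
    ∫ y, F (fiberTranslate γ y) ∂(rightMeasure (restrictHaar H lam) w) =
      ∫ x, F x ∂(rightMeasure lam v) := by
  rw [(measurePreserving_fiberTranslate hlam hH γ).integral_comp
    (isOpenEmbedding_fiberTranslate hH γ).measurableEmbedding]
  exact setIntegral_eq_integral_of_ae_compl_eq_zero hF

/-- The map `L²(G_v) → L²(H_w)` given by `(Q ξ)(h) = ξ(h γ)`. -/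
def restrictTranslate {v : C} {w : H.objs} (γ : v ⟶ (w : C)) :
    Lp ℂ 2 (rightMeasure lam v) →L[ℂ] Lp ℂ 2 (rightMeasure (restrictHaar H lam) w) :=
  (Lp.compMeasurePreservingₗᵢ ℂ (fiberTranslate γ)
    (measurePreserving_fiberTranslate hlam hH γ)).toContinuousLinearMap ∘L
      LpToLpRestrictCLM _ ℂ ℂ (rightMeasure lam v) 2 (Set.range (fiberTranslate γ))

theorem norm_restrictTranslate_le {v : C} {w : H.objs} (γ : v ⟶ (w : C)) :
    ‖restrictTranslate hlam hH γ‖ ≤ 1 := by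
  refine ContinuousLinearMap.opNorm_le_bound _ zero_le_one fun ξ => ?_
  rw [one_mul]
  exact (LinearIsometry.norm_map (Lp.compMeasurePreservingₗᵢ ℂ (fiberTranslate γ)
    (measurePreserving_fiberTranslate hlam hH γ)) _).trans_le (norm_Lp_toLp_restrict_le _ ξ)

theorem restrictTranslate_ae {v : C} {w : H.objs} (γ : v ⟶ (w : C))
    (ξ : Lp ℂ 2 (rightMeasure lam v)) :
    restrictTranslate hlam hH γ ξ =ᵐ[rightMeasure (restrictHaar H lam) w]
      fun y => ξ (fiberTranslate γ y) := by
  refine (Lp.coeFn_compMeasurePreserving _ (measurePreserving_fiberTranslate hlam hH γ)).trans ?_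
  exact (measurePreserving_fiberTranslate hlam hH γ).quasiMeasurePreserving.ae_eq_comp
    (LpToLpRestrictCLM_coeFn ℂ (Set.range (fiberTranslate γ)) ξ)

/-- Restriction from `⨁ᵥ L²(Gᵥ)` to `⨁_w L²(H_w)`. -/
def restrictRep : RegularRepSpace lam →L[ℂ] RegularRepSpace (restrictHaar H lam) :=
  lpDiag (σ := Subtype.val) Subtype.val_injective
    (fun w : H.objs => restrictTranslate hlam hH (𝟙 (w : C))) 1
    fun _ => norm_restrictTranslate_le hlam hH _

theorem restrictRep_apply (ξ : RegularRepSpace lam) (w : H.objs) :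
    restrictRep hlam hH ξ w = restrictTranslate hlam hH (𝟙 (w : C)) (ξ w) := rfl

/-- `⨁ᵥ L²(Gᵥ) → L²(G_v) → L²(H_w) → ⨁_w L²(H_w)`, the middle map being `restrictTranslate`. -/
def restrictTranslateRep {v : C} {w : H.objs} (γ : v ⟶ (w : C)) :
    RegularRepSpace lam →L[ℂ] RegularRepSpace (restrictHaar H lam) :=
  open Classical in
  (lp.singleContinuousLinearMap ℂ (fun w : H.objs =>
    Lp ℂ 2 (rightMeasure (restrictHaar H lam) w)) 2 w) ∘L
    restrictTranslate hlam hH γ ∘L lp.evalCLM ℂ (fun v : C => Lp ℂ 2 (rightMeasure lam v)) 2 v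

end Translation

/-! ### Compressions and intertwining relations -/

section OperatorCompression

open ContinuousLinearMap (adjoint)

variable {E F : Type*} [NormedAddCommGroup E] [InnerProductSpace ℂ E] [CompleteSpace E]
  [NormedAddCommGroup F] [InnerProductSpace ℂ F] [CompleteSpace F]

/-- The compression `T ↦ R T R⋆`. -/
def operatorCompression (R : E →L[ℂ] F) : (E →L[ℂ] E) →L[ℂ] (F →L[ℂ] F) where
  toFun T := R ∘L T ∘L adjoint R
  map_add' S T := by rw [ContinuousLinearMap.add_comp, ContinuousLinearMap.comp_add]
  map_smul' c T := by
    rw [ContinuousLinearMap.smul_comp, ContinuousLinearMap.comp_smul, RingHom.id_apply]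
  cont := continuous_const.clm_comp (continuous_id.clm_comp continuous_const)

theorem norm_operatorCompression_le {R : E →L[ℂ] F} (hR : ‖R‖ ≤ 1) (T : E →L[ℂ] E) :
    ‖operatorCompression R T‖ ≤ ‖T‖ := by
  have h2 : ‖adjoint R‖ ≤ 1 := by rwa [LinearIsometryEquiv.norm_map]
  calc ‖operatorCompression R T‖ ≤ ‖R‖ * (‖T‖ * ‖adjoint R‖) :=
        (ContinuousLinearMap.opNorm_comp_le _ _).trans
          (by gcongr; exact ContinuousLinearMap.opNorm_comp_le _ _)
    _ ≤ 1 * (‖T‖ * 1) := by gcongr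
    _ = ‖T‖ := by ring

theorem operatorCompression_star (R : E →L[ℂ] F) (T : E →L[ℂ] E) :
    operatorCompression R (star T) = star (operatorCompression R T) := by
  change R ∘L adjoint T ∘L adjoint R = adjoint (R ∘L T ∘L adjoint R)
  simp only [ContinuousLinearMap.adjoint_comp, ContinuousLinearMap.adjoint_adjoint,
    ContinuousLinearMap.comp_assoc]

/-- `Q` intertwines `T` with its compression by `R`. -/
def CompressionIntertwines (R Q : E →L[ℂ] F) (T : E →L[ℂ] E) : Prop :=
  Q ∘L T = operatorCompression R T ∘L Q

namespace CompressionIntertwines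

variable {R Q : E →L[ℂ] F} {S T : E →L[ℂ] E}

/-- From R S = (R S R⋆) R it follows that R S T R⋆ = (R S R⋆)(R T R⋆); nothing is asked of T. -/
theorem operatorCompression_mul (hS : CompressionIntertwines R R S) :
    operatorCompression R (S * T) = operatorCompression R S * operatorCompression R T := by
  calc operatorCompression R (S * T) = (R ∘L S) ∘L T ∘L adjoint R := rfl
    _ = (operatorCompression R S ∘L R) ∘L T ∘L adjoint R := by rw [hS]
    _ = _ := rfl

theorem zero : CompressionIntertwines R Q 0 := by
  rw [CompressionIntertwines, map_zero, ContinuousLinearMap.comp_zero,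
    ContinuousLinearMap.zero_comp]

theorem add (hS : CompressionIntertwines R Q S) (hT : CompressionIntertwines R Q T) :
    CompressionIntertwines R Q (S + T) := by
  rw [CompressionIntertwines, map_add, ContinuousLinearMap.comp_add, hS, hT,
    ContinuousLinearMap.add_comp]

theorem smul (hT : CompressionIntertwines R Q T) (c : ℂ) : CompressionIntertwines R Q (c • T) := by
  rw [CompressionIntertwines, map_smul, ContinuousLinearMap.comp_smul, hT,
    ContinuousLinearMap.smul_comp]

theorem mul (hS' : CompressionIntertwines R R S) (hS : CompressionIntertwines R Q S)
    (hT : CompressionIntertwines R Q T) : CompressionIntertwines R Q (S * T) := by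
  rw [CompressionIntertwines, hS'.operatorCompression_mul]
  calc Q ∘L (S * T) = (Q ∘L S) ∘L T := rfl
    _ = operatorCompression R S ∘L (Q ∘L T) := by rw [hS]; rfl
    _ = _ := by rw [hT]; rfl

theorem isClosed_setOf (R Q : E →L[ℂ] F) : IsClosed {T | CompressionIntertwines R Q T} :=
  isClosed_eq (continuous_const.clm_comp continuous_id)
    ((operatorCompression R).continuous.clm_comp continuous_const)

end CompressionIntertwines

end OperatorCompression

/-! ### Regular operators under compression to H -/

section Compression

/-- In product notation (yγ)(sγ)⁻¹ = y s⁻¹: the kernel does not see right translation. -/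
theorem groupoid_inv_comp_comp {C : Type u} [Groupoid.{v} C] {a b c d : C} (γ : a ⟶ b) (s : b ⟶ c)
    (y : b ⟶ d) : Groupoid.inv (γ ≫ s) ≫ γ ≫ y = Groupoid.inv s ≫ y := by
  simp

/-- In product notation (yγt⁻¹)⁻¹ y = tγ⁻¹. If y and yγt⁻¹ are in H, this places t in the coset Hγ.
-/
theorem groupoid_comp_inv_inv_comp {C : Type u} [Groupoid.{v} C] {a b c d : C} (γ : a ⟶ b)
    (y : b ⟶ c) (t : a ⟶ d) :
    y ≫ Groupoid.inv (Groupoid.inv t ≫ γ ≫ y) = Groupoid.inv γ ≫ t := by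
  simp

variable {C : Type u} [Groupoid.{v} C] {H : Subgroupoid C} [TopologicalSpace (Arrows C)]
  [IsLocallyCompactGroupoid C] {lam : ∀ w : C, Measure (RangeFiber w)} (hlam : IsHaarSystem lam)
  (hH : IsClopen (arrowSet H))

theorem norm_restrictRep_le : ‖restrictRep hlam hH‖ ≤ 1 :=
  (norm_lpDiag_le _ _ _ _).trans_eq abs_one

theorem inner_restrictTranslate {v : C} {w : H.objs} (γ : v ⟶ (w : C))
    {ξ : Lp ℂ 2 (rightMeasure lam v)}
    (hξ : ∀ᵐ x ∂(rightMeasure lam v), x ∉ Set.range (fiberTranslate γ) → ξ x = 0)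
    (ζ : Lp ℂ 2 (rightMeasure lam v)) :
    inner ℂ (restrictTranslate hlam hH γ ξ) (restrictTranslate hlam hH γ ζ) = inner ℂ ξ ζ := by
  rw [L2.inner_def, L2.inner_def, ← integral_fiberTranslate hlam hH γ]
  · refine integral_congr_ae ?_
    filter_upwards [restrictTranslate_ae hlam hH γ ξ, restrictTranslate_ae hlam hH γ ζ]
      with x hx hx'
    rw [hx, hx']
  · filter_upwards [hξ] with x hx hx'
    rw [hx hx', inner_zero_left]

theorem exists_restrictTranslate_eq {v : C} {w : H.objs} (γ : v ⟶ (w : C))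
    (η : Lp ℂ 2 (rightMeasure (restrictHaar H lam) w)) :
    ∃ ξ : Lp ℂ 2 (rightMeasure lam v), restrictTranslate hlam hH γ ξ = η ∧
      ∀ᵐ x ∂(rightMeasure lam v), x ∉ Set.range (fiberTranslate γ) → ξ x = 0 := by
  have he := (isOpenEmbedding_fiberTranslate hH γ).measurableEmbedding
  have hmp := measurePreserving_fiberTranslate hlam hH γ
  let F : SourceFiber v → ℂ := Function.extend (fiberTranslate γ) η 0
  have hF : ∀ x, x ∉ Set.range (fiberTranslate γ) → F x = 0 := fun x hx =>
    Function.extend_apply' _ _ _ hx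
  have hFc : F ∘ fiberTranslate γ = η := Function.extend_comp he.injective _ _
  have hF2 : MemLp F 2 (rightMeasure lam v) := by
    have h1 : (Set.range (fiberTranslate γ)).indicator F = F :=
      Set.indicator_eq_self.mpr fun x hx => by_contra fun h => hx (hF x h)
    rw [← h1, memLp_indicator_iff_restrict he.measurableSet_range, ← hmp.map_eq,
      he.memLp_map_measure_iff, hFc]
    exact Lp.memLp η
  refine ⟨hF2.toLp F, Lp.ext ?_, ?_⟩
  · filter_upwards [restrictTranslate_ae hlam hH γ (hF2.toLp F),
      ae_fiberTranslate hlam hH γ hF2.coeFn_toLp] with x hx hx'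
    rw [hx, hx']
    exact congrFun hFc x
  · filter_upwards [hF2.coeFn_toLp] with x hx hx'
    rw [hx, hF x hx']

/-- The adjoint is extension by zero. Componentwise preimages supported in H_w, and zero over the
units outside H, form a vector ξ with the same norms as η, hence in the Hilbert sum; pairing it with
any vector shows that it is R⋆η. -/
theorem adjoint_restrictRep_spec (η : RegularRepSpace (restrictHaar H lam)) :
    restrictRep hlam hH (ContinuousLinearMap.adjoint (restrictRep hlam hH) η) = η ∧
    (∀ w : H.objs, ∀ᵐ x ∂(rightMeasure lam w), x ∉ Set.range (fiberTranslate (𝟙 (w : C))) →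
      (ContinuousLinearMap.adjoint (restrictRep hlam hH) η) w x = 0) ∧
    ∀ v, v ∉ H.objs → (ContinuousLinearMap.adjoint (restrictRep hlam hH) η) v = 0 := by
  classical
  choose ζ hζ hζ' using fun w : H.objs => exists_restrictTranslate_eq hlam hH (𝟙 (w : C)) (η w)
  let Z : ∀ v : C, Lp ℂ 2 (rightMeasure lam v) := fun v => if h : v ∈ H.objs then ζ ⟨v, h⟩ else 0
  have hZ : ∀ w : H.objs, Z w = ζ w := fun w => dif_pos w.2
  have hZ0 : ∀ v, v ∉ H.objs → Z v = 0 := fun v hv => dif_neg hv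
  have hrange : ∀ v, v ∉ Set.range (Subtype.val : H.objs → C) → v ∉ H.objs := fun v hv h =>
    hv ⟨⟨v, h⟩, rfl⟩
  have hnorm : ∀ w : H.objs, ‖Z w‖ = ‖η w‖ := fun w => by
    rw [hZ, @norm_eq_sqrt_re_inner ℂ, @norm_eq_sqrt_re_inner ℂ _ _ _ _ (η w),
      ← inner_restrictTranslate hlam hH _ (hζ' w), hζ w]
  have hmem : Memℓp Z 2 := by
    refine memℓp_gen ((Subtype.val_injective.summable_iff fun v hv => ?_).mp
      (((lp.memℓp η).summable (by norm_num)).congr fun w => ?_))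
    · simp [hZ0 v (hrange v hv)]
    · simp [hnorm]
  let ξ : RegularRepSpace lam := ⟨Z, hmem⟩
  have hR : restrictRep hlam hH ξ = η := by
    ext1
    funext w
    rw [restrictRep_apply]
    exact (congrArg _ (hZ w)).trans (hζ w)
  have hadj : ContinuousLinearMap.adjoint (restrictRep hlam hH) η = ξ := by
    refine ext_inner_right ℂ fun χ => ?_
    rw [ContinuousLinearMap.adjoint_inner_left, lp.inner_eq_tsum, lp.inner_eq_tsum,
      ← Subtype.val_injective.tsum_eq (f := fun v => inner ℂ (ξ v) (χ v))]
    · refine tsum_congr fun w => ?_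
      rw [restrictRep_apply, ← hζ w, inner_restrictTranslate hlam hH _ (hζ' w), ← hZ w]
    · intro v hv
      by_contra h
      refine hv ?_
      change inner ℂ (Z v) (χ v) = 0
      rw [hZ0 v (hrange v h), inner_zero_left]
  rw [hadj]
  refine ⟨hR, fun w => ?_, hZ0⟩
  change ∀ᵐ x ∂(rightMeasure lam w), _ → (Z w) x = 0
  rw [hZ w]
  exact hζ' w

/-- The integral over G_v reduces to the coset Hγ as soon as the rest contributes nothing. This
occurs in two ways: ξ is supported on the coset (for the compression), or f is supported in H (for
the intertwining). -/
theorem restrictTranslate_regularOperator {f : Arrows C → ℂ}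
    {T : RegularRepSpace lam →L[ℂ] RegularRepSpace lam} (hT : IsRegularOperator lam f T)
    {v : C} {w : H.objs} (γ : v ⟶ (w : C)) (ξ : RegularRepSpace lam)
    (h : ∀ y : SourceFiber w, ∀ᵐ t ∂(rightMeasure lam v), t ∉ Set.range (fiberTranslate γ) →
      regularKernel f v (fiberTranslate γ y) t * ξ v t = 0) :
    ∀ᵐ y ∂(rightMeasure (restrictHaar H lam) w), restrictTranslate hlam hH γ (T ξ v) y =
      ∫ s, restrictFun H f (Arrows.mk (Groupoid.inv s.hom ≫ y.hom)) *
        restrictTranslate hlam hH γ (ξ v) s ∂(rightMeasure (restrictHaar H lam) w) := by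
  filter_upwards [restrictTranslate_ae hlam hH γ (T ξ v),
    ae_fiberTranslate hlam hH γ (hT ξ v)] with y hy hy'
  rw [hy, hy']
  refine (integral_fiberTranslate hlam hH γ (h y)).symm.trans (integral_congr_ae ?_)
  filter_upwards [restrictTranslate_ae hlam hH γ (ξ v)] with s hs
  rw [hs]
  congr 1
  simp only [regularKernel, restrictFun, fiberTranslate, inclArrows]
  refine congrArg f (congrArg Arrows.mk ?_)
  exact groupoid_inv_comp_comp γ _ _

/-- Compression to `⨁_w L²(H_w)` restricts functions to `H`. -/
theorem IsRegularOperator.compression {f : Arrows C → ℂ}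
    {T : RegularRepSpace lam →L[ℂ] RegularRepSpace lam} (hT : IsRegularOperator lam f T) :
    IsRegularOperator (restrictHaar H lam) (restrictFun H f)
      (operatorCompression (restrictRep hlam hH) T) := by
  intro η w
  obtain ⟨h1, h2, -⟩ := adjoint_restrictRep_spec hlam hH η
  set ξ := ContinuousLinearMap.adjoint (restrictRep hlam hH) η with hξ
  have h3 : restrictTranslate hlam hH (𝟙 (w : C)) (ξ w) = η w := by
    rw [← restrictRep_apply, h1]
  have h4 := restrictTranslate_regularOperator hlam hH hT (𝟙 (w : C)) ξ fun y => by
    filter_upwards [h2 w] with t ht ht'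
    rw [ht ht', mul_zero]
  rw [h3] at h4
  exact h4

include hH in
-- A unit belongs to H exactly when its identity arrow does, and H is closed while x ↦ r(x) is
-- continuous.
theorem isOpen_cod_notMem_objs (v : C) : IsOpen {x : SourceFiber v | x.cod ∉ H.objs} := by
  have h1 : Continuous fun x : SourceFiber v => Arrows.mk (𝟙 x.cod) :=
    continuous_induced_dom.comp
      (Arrows.continuous_unitCod.comp (SourceFiber.isEmbedding_toArrow v).continuous)
  convert hH.compl.isOpen.preimage h1 using 1
  ext x
  exact not_congr ⟨H.id_mem_of_nonempty_isotropy _, H.mem_objs_of_src⟩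

/-- The restriction map to arrows with range outside the units of `H`. -/
def restrictOutside (H : Subgroupoid C) (lam : ∀ w : C, Measure (RangeFiber w)) (v : C) :
    RegularRepSpace lam →L[ℂ]
      Lp ℂ 2 ((rightMeasure lam v).restrict {x : SourceFiber v | x.cod ∉ H.objs}) :=
  LpToLpRestrictCLM _ ℂ ℂ (rightMeasure lam v) 2 _ ∘L
    lp.evalCLM ℂ (fun v : C => Lp ℂ 2 (rightMeasure lam v)) 2 v

/-- Operators that act on the translates of `H` in `Gᵥ` as their compression does, and vanish
outside. -/
structure RestrictIntertwines (T : RegularRepSpace lam →L[ℂ] RegularRepSpace lam) : Prop where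
  restrict : CompressionIntertwines (restrictRep hlam hH) (restrictRep hlam hH) T
  translate : ∀ {v : C} {w : H.objs} (γ : v ⟶ (w : C)),
    CompressionIntertwines (restrictRep hlam hH) (restrictTranslateRep hlam hH γ) T
  outside : ∀ v, restrictOutside H lam v ∘L T = 0

/-- `restrictTranslateRep` takes values in the whole Hilbert sum, with a single component, so that
it can be composed with the compressed operator. -/
theorem restrictTranslateRep_apply_self {v : C} {w : H.objs} (γ : v ⟶ (w : C))
    (ξ : RegularRepSpace lam) :
    restrictTranslateRep hlam hH γ ξ w = restrictTranslate hlam hH γ (ξ v) := by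
  classical
  exact lp.single_apply_self (E := fun w : H.objs =>
    Lp ℂ 2 (rightMeasure (restrictHaar H lam) w)) 2 w _

theorem restrictTranslateRep_apply_ne {v : C} {w w' : H.objs} (γ : v ⟶ (w : C)) (h : w' ≠ w)
    (ξ : RegularRepSpace lam) : restrictTranslateRep hlam hH γ ξ w' = 0 := by
  classical
  exact lp.single_apply_ne (E := fun w : H.objs =>
    Lp ℂ 2 (rightMeasure (restrictHaar H lam) w)) 2 w _ h

/-- With f supported in H, the kernel couples x only to t in the same coset of H, and vanishes when
r(x) is not a unit of H. -/
theorem IsRegularOperator.restrictIntertwines {f : Arrows C → ℂ}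
    {T : RegularRepSpace lam →L[ℂ] RegularRepSpace lam} (hT : IsRegularOperator lam f T)
    (hf : ∀ x, x ∉ arrowSet H → f x = 0) : RestrictIntertwines hlam hH T := by
  have hS := hT.compression hlam hH
  have key : ∀ {v : C} {w : H.objs} (γ : v ⟶ (w : C)) (ξ : RegularRepSpace lam),
      ∀ᵐ y ∂(rightMeasure (restrictHaar H lam) w), restrictTranslate hlam hH γ (T ξ v) y =
        ∫ s, restrictFun H f (Arrows.mk (Groupoid.inv s.hom ≫ y.hom)) *
          restrictTranslate hlam hH γ (ξ v) s ∂(rightMeasure (restrictHaar H lam) w) := by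
    refine fun {v w} γ ξ => restrictTranslate_regularOperator hlam hH hT γ ξ fun y =>
      .of_forall fun t ht => ?_
    rw [regularKernel, hf, zero_mul]
    refine fun hmem => ht ((mem_range_fiberTranslate γ t).mpr ?_)
    have h1 : (y.hom.1 : (w : C) ⟶ (y.cod : C)) ≫
        Groupoid.inv (Groupoid.inv t.hom ≫ γ ≫ (y.hom.1 : (w : C) ⟶ (y.cod : C))) ∈
        H.arrows w t.cod := H.mul y.hom.2 (H.inv hmem)
    rwa [groupoid_comp_inv_inv_comp] at h1
  refine ⟨?_, fun {v w} γ => ?_, fun v => ?_⟩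
  · ext ξ w
    filter_upwards [key (𝟙 (w : C)) ξ, hS (restrictRep hlam hH ξ) w] with y h1 h2
    exact h1.trans h2.symm
  · ext1 ξ
    ext1
    funext w'
    by_cases h : w' = w
    · subst h
      refine (restrictTranslateRep_apply_self hlam hH γ (T ξ)).trans (Lp.ext ?_)
      filter_upwards [key γ ξ, hS (restrictTranslateRep hlam hH γ ξ) w'] with y h1 h2
      rw [restrictTranslateRep_apply_self] at h2
      exact h1.trans h2.symm
    · refine (restrictTranslateRep_apply_ne hlam hH γ h (T ξ)).trans (Lp.ext ?_)
      filter_upwards [hS (restrictTranslateRep hlam hH γ ξ) w', Lp.coeFn_zero ℂ 2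
        (rightMeasure (restrictHaar H lam) w')] with y h1 h2
      refine h2.trans (Eq.trans ?_ h1.symm)
      rw [restrictTranslateRep_apply_ne hlam hH γ h]
      refine (integral_eq_zero_of_ae ?_).symm
      filter_upwards [Lp.coeFn_zero ℂ 2 (rightMeasure (restrictHaar H lam) w')] with s hs
      rw [hs]
      simp
  · ext1 ξ
    refine Lp.ext ?_
    have hmeas : ∀ᵐ x ∂((rightMeasure lam v).restrict {x : SourceFiber v | x.cod ∉ H.objs}),
        x.cod ∉ H.objs := by
      exact ae_restrict_mem (isOpen_cod_notMem_objs hH v).measurableSet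
    filter_upwards [LpToLpRestrictCLM_coeFn ℂ {x : SourceFiber v | x.cod ∉ H.objs} (T ξ v),
      ae_restrict_of_ae (hT ξ v), Lp.coeFn_zero ℂ 2
        ((rightMeasure lam v).restrict {x : SourceFiber v | x.cod ∉ H.objs}), hmeas] with
      x h1 h2 h3 h4
    refine h1.trans (h2.trans (Eq.trans ?_ h3.symm))
    refine integral_eq_zero_of_ae (.of_forall fun t => ?_)
    change f _ * _ = 0
    rw [hf, zero_mul]
    exact fun hmem => h4 (H.mem_objs_of_tgt hmem)

/-- If the compression is zero, the intertwining relations make T ξ vanish on every coset Hγ and on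
the arrows with range outside the units of H. These open sets cover the fibre, and second
countability makes a locally null set null. -/
theorem RestrictIntertwines.eq_zero {T : RegularRepSpace lam →L[ℂ] RegularRepSpace lam}
    (hT : RestrictIntertwines hlam hH T)
    (h : operatorCompression (restrictRep hlam hH) T = 0) : T = 0 := by
  ext1 ξ
  ext1
  funext v
  refine Lp.ext ?_
  have h1 : ∀ᵐ x ∂(rightMeasure lam v), T ξ v x = 0 := by
    refine measure_null_of_locally_null _ fun x hx => ?_
    suffices h2 : ∃ U : Set (SourceFiber v), IsOpen U ∧ x ∈ U ∧
        ∀ᵐ y ∂(rightMeasure lam v).restrict U, T ξ v y = 0 by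
      obtain ⟨U, hU, hxU, h2⟩ := h2
      rw [ae_restrict_iff' hU.measurableSet] at h2
      refine ⟨_ ∩ U, Filter.inter_mem self_mem_nhdsWithin
        (mem_nhdsWithin_of_mem_nhds (hU.mem_nhds hxU)), ?_⟩
      refine measure_mono_null (fun y hy => ?_) h2
      exact fun h3 => hy.1 (h3 hy.2)
    by_cases hc : x.cod ∈ H.objs
    -- The coset used near x is Hx itself, which contains x because the unit r(x) is in H.
    · let γ : v ⟶ ((⟨x.cod, hc⟩ : H.objs) : C) := x.hom
      have he := (isOpenEmbedding_fiberTranslate hH γ)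
      refine ⟨_, he.isOpen_range, (mem_range_fiberTranslate γ x).mpr ?_, ?_⟩
      · rw [Groupoid.inv_comp]
        exact H.id_mem_of_nonempty_isotropy _ hc
      rw [← (measurePreserving_fiberTranslate hlam hH γ).map_eq,
        he.measurableEmbedding.ae_map_iff]
      have h2 := hT.translate γ
      rw [CompressionIntertwines, h, ContinuousLinearMap.zero_comp] at h2
      have h3 := restrictTranslateRep_apply_self hlam hH γ (T ξ)
      rw [show restrictTranslateRep hlam hH γ (T ξ) = 0 from DFunLike.congr_fun h2 ξ] at h3
      filter_upwards [restrictTranslate_ae hlam hH γ (T ξ v), Lp.coeFn_zero ℂ 2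
        (rightMeasure (restrictHaar H lam) ⟨x.cod, hc⟩)] with y hy hy'
      rw [← hy, ← h3]
      exact hy'
    · refine ⟨_, isOpen_cod_notMem_objs hH v, hc, ?_⟩
      have h2 : restrictOutside H lam v (T ξ) = 0 := DFunLike.congr_fun (hT.outside v) ξ
      filter_upwards [LpToLpRestrictCLM_coeFn ℂ {x : SourceFiber v | x.cod ∉ H.objs} (T ξ v),
        Lp.coeFn_zero ℂ 2 ((rightMeasure lam v).restrict {x : SourceFiber v | x.cod ∉ H.objs})]
        with y hy hy'
      rw [← hy]
      refine Eq.trans ?_ hy'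
      rw [← h2]
      rfl
  filter_upwards [h1, Lp.coeFn_zero ℂ 2 (rightMeasure lam v)] with x hx hx'
  exact hx.trans hx'.symm

end Compression

/-! ### The inclusion and the conditional expectation -/

section Inclusion

open ContinuousLinearMap (adjoint)

variable {C : Type u} [Groupoid.{v} C] {H : Subgroupoid C} [TopologicalSpace (Arrows C)]
  [IsLocallyCompactGroupoid C] {lam : ∀ w : C, Measure (RangeFiber w)} (hlam : IsHaarSystem lam)
  (hH : IsClopen (arrowSet H))

/-- The compression `T ↦ R T R⋆` to `⨁_w L²(H_w)`. -/
def compress : (RegularRepSpace lam →L[ℂ] RegularRepSpace lam) →L[ℂ]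
    (RegularRepSpace (restrictHaar H lam) →L[ℂ] RegularRepSpace (restrictHaar H lam)) :=
  operatorCompression (restrictRep hlam hH)

theorem norm_compress_le (T : RegularRepSpace lam →L[ℂ] RegularRepSpace lam) :
    ‖compress hlam hH T‖ ≤ ‖T‖ :=
  norm_operatorCompression_le (norm_restrictRep_le hlam hH) T

theorem compress_star (T : RegularRepSpace lam →L[ℂ] RegularRepSpace lam) :
    compress hlam hH (star T) = star (compress hlam hH T) :=
  operatorCompression_star _ T

/-- Compression sends [f]_G to [f|_H]_H; continuity extends this to limits because the target
algebra is closed. -/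
theorem compress_mem {T : RegularRepSpace lam →L[ℂ] RegularRepSpace lam}
    (hT : T ∈ reducedSubalgebra lam) :
    compress hlam hH T ∈ reducedSubalgebra (restrictHaar H lam) := by
  have h1 := map_mem_closure (compress hlam hH).continuous
    (hlam.reducedSubalgebra_subset_closure hT)
    (t := (reducedSubalgebra (restrictHaar H lam) : Set _)) (by
      rintro S ⟨f, hf, hS⟩
      exact mem_reducedSubalgebra_of_isRegularOperator (restrictFun_mem_Cc hH hf)
        (hS.compression hlam hH))
  exact (NonUnitalStarSubalgebra.isClosed_topologicalClosure _).closure_eq.subset h1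

namespace RestrictIntertwines

variable {hlam hH} {S T : RegularRepSpace lam →L[ℂ] RegularRepSpace lam}

theorem zero : RestrictIntertwines hlam hH 0 where
  restrict := .zero
  translate _ := .zero
  outside _ := ContinuousLinearMap.comp_zero _

theorem add (hS : RestrictIntertwines hlam hH S) (hT : RestrictIntertwines hlam hH T) :
    RestrictIntertwines hlam hH (S + T) where
  restrict := hS.restrict.add hT.restrict
  translate γ := (hS.translate γ).add (hT.translate γ)
  outside v := by rw [ContinuousLinearMap.comp_add, hS.outside, hT.outside, add_zero]

theorem smul (hT : RestrictIntertwines hlam hH T) (c : ℂ) :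
    RestrictIntertwines hlam hH (c • T) where
  restrict := hT.restrict.smul c
  translate γ := (hT.translate γ).smul c
  outside v := by rw [ContinuousLinearMap.comp_smul, hT.outside, smul_zero]

theorem mul (hS : RestrictIntertwines hlam hH S) (hT : RestrictIntertwines hlam hH T) :
    RestrictIntertwines hlam hH (S * T) where
  restrict := hS.restrict.mul hS.restrict hT.restrict
  translate γ := hS.restrict.mul (hS.translate γ) (hT.translate γ)
  outside v := by
    rw [ContinuousLinearMap.mul_def, ← ContinuousLinearMap.comp_assoc, hS.outside,
      ContinuousLinearMap.zero_comp]

variable (hlam hH) in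
theorem isClosed_setOf : IsClosed {T | RestrictIntertwines hlam hH T} := by
  have h1 : {T | RestrictIntertwines hlam hH T} =
      {T | CompressionIntertwines (restrictRep hlam hH) (restrictRep hlam hH) T} ∩
      ((⋂ (v : C) (w : H.objs) (γ : v ⟶ (w : C)),
        {T | CompressionIntertwines (restrictRep hlam hH) (restrictTranslateRep hlam hH γ) T}) ∩
      ⋂ v : C, {T | restrictOutside H lam v ∘L T = 0}) := by
    ext T
    simp only [Set.mem_inter_iff, Set.mem_iInter, Set.mem_ofPred_eq]
    exact ⟨fun h => ⟨h.restrict, fun _ _ γ => h.translate γ, h.outside⟩,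
      fun h => ⟨h.1, fun γ => h.2.1 _ _ γ, h.2.2⟩⟩
  rw [h1]
  refine (CompressionIntertwines.isClosed_setOf _ _).inter (IsClosed.inter ?_ ?_)
  · exact isClosed_iInter fun v => isClosed_iInter fun w => isClosed_iInter fun γ =>
      CompressionIntertwines.isClosed_setOf _ _
  · exact isClosed_iInter fun v =>
      isClosed_eq (continuous_const.clm_comp continuous_id) continuous_const

end RestrictIntertwines

/-- The operators that satisfy `RestrictIntertwines` together with their adjoints. -/
def intertwiningSubalgebra :
    NonUnitalStarSubalgebra ℂ (RegularRepSpace lam →L[ℂ] RegularRepSpace lam) where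
  carrier := {T | RestrictIntertwines hlam hH T ∧ RestrictIntertwines hlam hH (star T)}
  add_mem' := fun hS hT => ⟨hS.1.add hT.1, by rw [star_add]; exact hS.2.add hT.2⟩
  zero_mem' := ⟨.zero, by rw [star_zero]; exact .zero⟩
  mul_mem' := fun hS hT => ⟨hS.1.mul hT.1, by rw [star_mul]; exact hT.2.mul hS.2⟩
  smul_mem' := fun c _ hT => ⟨hT.1.smul c, by rw [star_smul]; exact hT.2.smul _⟩
  star_mem' := fun hT => ⟨hT.2, by rw [star_star]; exact hT.1⟩

theorem isClosed_intertwiningSubalgebra : IsClosed (intertwiningSubalgebra hlam hH :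
    Set (RegularRepSpace lam →L[ℂ] RegularRepSpace lam)) :=
  (RestrictIntertwines.isClosed_setOf hlam hH).inter
    ((RestrictIntertwines.isClosed_setOf hlam hH).preimage continuous_star)

/-- The closed `⋆`-algebra generated by the functions that are supported in `H`. -/
def extensionSubalgebra (H : Subgroupoid C) (lam : ∀ w : C, Measure (RangeFiber w)) :
    NonUnitalStarSubalgebra ℂ (RegularRepSpace lam →L[ℂ] RegularRepSpace lam) :=
  (NonUnitalStarAlgebra.adjoin ℂ
    {T | ∃ f ∈ Cc (Arrows H.objs), IsRegularOperator lam (extendByZero H f) T}).topologicalClosure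

omit [IsLocallyCompactGroupoid C] in
theorem IsRegularOperator.mem_extensionSubalgebra {f : Arrows H.objs → ℂ}
    (hf : f ∈ Cc (Arrows H.objs)) {T : RegularRepSpace lam →L[ℂ] RegularRepSpace lam}
    (hT : IsRegularOperator lam (extendByZero H f) T) : T ∈ extensionSubalgebra H lam :=
  NonUnitalStarSubalgebra.le_topologicalClosure _
    (NonUnitalStarAlgebra.subset_adjoin ℂ _ ⟨f, hf, hT⟩)

omit [IsLocallyCompactGroupoid C] in
include hH in
theorem extensionSubalgebra_le : extensionSubalgebra H lam ≤ reducedSubalgebra lam := by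
  refine NonUnitalStarSubalgebra.topologicalClosure_minimal _ (NonUnitalStarAlgebra.adjoin_le ?_)
    (NonUnitalStarSubalgebra.isClosed_topologicalClosure _)
  rintro T ⟨f, hf, hT⟩
  exact mem_reducedSubalgebra_of_isRegularOperator (extendByZero_mem_Cc hH hf) hT

/-- The relations in `RestrictIntertwines` are not visibly stable under adjoints, so both T and T⋆
are checked. Since H is closed under inversion, f⋆ also vanishes off H. -/
theorem extensionSubalgebra_le_intertwining :
    extensionSubalgebra H lam ≤ intertwiningSubalgebra hlam hH := by
  refine NonUnitalStarSubalgebra.topologicalClosure_minimal _ (NonUnitalStarAlgebra.adjoin_le ?_)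
    (isClosed_intertwiningSubalgebra hlam hH)
  rintro T ⟨f, hf, hT⟩
  have hf' := extendByZero_mem_Cc hH hf
  obtain ⟨T', hT'⟩ := hlam.exists_isRegularOperator (IsHaarSystem.Cc_groupoidStar hf')
  refine ⟨hT.restrictIntertwines hlam hH fun x hx => extendByZero_of_notMem f hx, ?_⟩
  rw [hlam.isRegularOperator_adjoint hf' hT hT']
  refine hT'.restrictIntertwines hlam hH fun x hx => ?_
  rw [groupoidStar, extendByZero_of_notMem, star_zero]
  exact fun h => hx (inv_mem_arrowSet_iff.mp h)

theorem eq_of_compress_eq {S T : RegularRepSpace lam →L[ℂ] RegularRepSpace lam}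
    (hS : S ∈ extensionSubalgebra H lam) (hT : T ∈ extensionSubalgebra H lam)
    (h : compress hlam hH S = compress hlam hH T) : S = T := by
  rw [← sub_eq_zero]
  refine (extensionSubalgebra_le_intertwining hlam hH (sub_mem hS hT)).1.eq_zero hlam hH ?_
  have := map_sub (compress hlam hH) S T
  rwa [h, sub_self] at this

theorem compress_mul_of_mem {S T : RegularRepSpace lam →L[ℂ] RegularRepSpace lam}
    (hS : S ∈ extensionSubalgebra H lam) :
    compress hlam hH (S * T) = compress hlam hH S * compress hlam hH T :=
  (extensionSubalgebra_le_intertwining hlam hH hS).1.restrict.operatorCompression_mul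

theorem compress_mul_of_mem_right {S T : RegularRepSpace lam →L[ℂ] RegularRepSpace lam}
    (hT : T ∈ extensionSubalgebra H lam) :
    compress hlam hH (S * T) = compress hlam hH S * compress hlam hH T := by
  apply star_injective
  rw [← compress_star, star_mul, compress_mul_of_mem hlam hH (star_mem hT), compress_star,
    compress_star, star_mul]

instance (H : Subgroupoid C) (lam : ∀ w : C, Measure (RangeFiber w)) :
    NonUnitalCStarAlgebra (extensionSubalgebra H lam) :=
  NonUnitalStarSubalgebra.nonUnitalCStarAlgebra (extensionSubalgebra H lam)
    (h_closed := NonUnitalStarSubalgebra.isClosed_topologicalClosure _)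

/-- Compression is multiplicative on the algebra generated by the functions supported in `H`. -/
def compressHom : extensionSubalgebra H lam →⋆ₙₐ[ℂ]
    (RegularRepSpace (restrictHaar H lam) →L[ℂ] RegularRepSpace (restrictHaar H lam)) where
  toFun T := compress hlam hH T
  map_smul' c T := map_smul (compress hlam hH) c T.1
  map_zero' := map_zero (compress hlam hH)
  map_add' S T := map_add (compress hlam hH) S.1 T.1
  map_mul' S _ := compress_mul_of_mem hlam hH S.2
  map_star' T := compress_star hlam hH T.1

theorem compressHom_injective : Function.Injective (compressHom hlam hH) := fun S T h =>
  Subtype.ext (eq_of_compress_eq hlam hH S.2 T.2 h)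

/-- The range of compression contains every regular operator of H, because f is the restriction of
its extension by zero. The range is closed because an injective ⋆-homomorphism of C⋆-algebras is
isometric. -/
theorem reducedSubalgebra_restrictHaar_le :
    reducedSubalgebra (restrictHaar H lam) ≤ NonUnitalStarAlgHom.range (compressHom hlam hH) := by
  refine NonUnitalStarSubalgebra.topologicalClosure_minimal _ (NonUnitalStarAlgebra.adjoin_le ?_) ?_
  · rintro S ⟨f, hf, hS⟩
    obtain ⟨T, hT⟩ := hlam.exists_isRegularOperator (extendByZero_mem_Cc hH hf)
    refine ⟨⟨T, hT.mem_extensionSubalgebra hf⟩, ?_⟩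
    have h1 := hT.compression hlam hH
    rw [restrictFun_extendByZero] at h1
    exact h1.eq hS
  · exact (NonUnitalStarAlgHom.isometry _ (compressHom_injective hlam hH)).isClosedEmbedding.isClosed_range

theorem exists_compress_eq (a : ReducedCStarAlgebra (restrictHaar H lam)) :
    ∃ T ∈ extensionSubalgebra H lam, compress hlam hH T = a.toOperator := by
  obtain ⟨T, hT⟩ := reducedSubalgebra_restrictHaar_le hlam hH a.2
  exact ⟨T.1, T.2, hT⟩

/-- The operator of the algebra of functions supported in `H` whose compression is `a`. -/
def liftOperator (a : ReducedCStarAlgebra (restrictHaar H lam)) :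
    RegularRepSpace lam →L[ℂ] RegularRepSpace lam := (exists_compress_eq hlam hH a).choose

theorem liftOperator_mem (a : ReducedCStarAlgebra (restrictHaar H lam)) :
    liftOperator hlam hH a ∈ extensionSubalgebra H lam :=
  (exists_compress_eq hlam hH a).choose_spec.1

theorem compress_liftOperator (a : ReducedCStarAlgebra (restrictHaar H lam)) :
    compress hlam hH (liftOperator hlam hH a) = a.toOperator :=
  (exists_compress_eq hlam hH a).choose_spec.2

/-- Compression is injective on the extension algebra, so the chosen lift is the only one. Each
algebraic property of the inclusion thus reduces to checking a candidate. -/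
theorem liftOperator_eq {a : ReducedCStarAlgebra (restrictHaar H lam)}
    {T : RegularRepSpace lam →L[ℂ] RegularRepSpace lam} (hT : T ∈ extensionSubalgebra H lam)
    (h : compress hlam hH T = a.toOperator) : liftOperator hlam hH a = T :=
  eq_of_compress_eq hlam hH (liftOperator_mem hlam hH a) hT
    ((compress_liftOperator hlam hH a).trans h.symm)

theorem liftOperator_smul (c : ℂ) (a : ReducedCStarAlgebra (restrictHaar H lam)) :
    liftOperator hlam hH (c • a) = c • liftOperator hlam hH a :=
  liftOperator_eq hlam hH (SMulMemClass.smul_mem c (liftOperator_mem hlam hH a))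
    ((map_smul (compress hlam hH) c _).trans (congrArg _ (compress_liftOperator hlam hH a)))

theorem liftOperator_zero : liftOperator hlam hH (0 : ReducedCStarAlgebra (restrictHaar H lam)) = 0 :=
  liftOperator_eq hlam hH (zero_mem _) (map_zero (compress hlam hH))

theorem liftOperator_add (a b : ReducedCStarAlgebra (restrictHaar H lam)) :
    liftOperator hlam hH (a + b) = liftOperator hlam hH a + liftOperator hlam hH b :=
  liftOperator_eq hlam hH (add_mem (liftOperator_mem hlam hH a) (liftOperator_mem hlam hH b))
    ((map_add (compress hlam hH) _ _).trans
      (congrArg₂ _ (compress_liftOperator hlam hH a) (compress_liftOperator hlam hH b)))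

theorem liftOperator_mul (a b : ReducedCStarAlgebra (restrictHaar H lam)) :
    liftOperator hlam hH (a * b) = liftOperator hlam hH a * liftOperator hlam hH b :=
  liftOperator_eq hlam hH (mul_mem (liftOperator_mem hlam hH a) (liftOperator_mem hlam hH b))
    ((compress_mul_of_mem hlam hH (liftOperator_mem hlam hH a)).trans
      (congrArg₂ _ (compress_liftOperator hlam hH a) (compress_liftOperator hlam hH b)))

theorem liftOperator_star (a : ReducedCStarAlgebra (restrictHaar H lam)) :
    liftOperator hlam hH (star a) = star (liftOperator hlam hH a) :=
  liftOperator_eq hlam hH (star_mem (liftOperator_mem hlam hH a))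
    ((compress_star hlam hH _).trans (congrArg _ (compress_liftOperator hlam hH a)))

/-- The inclusion `C⋆ᵣ(H, λ_H) → C⋆ᵣ(G, λ)`. -/
def reducedInclusion :
    ReducedCStarAlgebra (restrictHaar H lam) →⋆ₙₐ[ℂ] ReducedCStarAlgebra lam where
  toFun a := ⟨liftOperator hlam hH a, extensionSubalgebra_le hH (liftOperator_mem hlam hH a)⟩
  map_smul' c a := Subtype.ext (liftOperator_smul hlam hH c a)
  map_zero' := Subtype.ext (liftOperator_zero hlam hH)
  map_add' a b := Subtype.ext (liftOperator_add hlam hH a b)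
  map_mul' a b := Subtype.ext (liftOperator_mul hlam hH a b)
  map_star' a := Subtype.ext (liftOperator_star hlam hH a)

/-- `ReducedCStarAlgebra.toOperator` as a `⋆`-homomorphism. -/
def toOperatorHom {C : Type u} [Groupoid.{v} C] [TopologicalSpace (Arrows C)]
    (lam : ∀ w : C, Measure (RangeFiber w)) :
    ReducedCStarAlgebra lam →⋆ₙₐ[ℂ] (RegularRepSpace lam →L[ℂ] RegularRepSpace lam) where
  toFun := ReducedCStarAlgebra.toOperator
  map_smul' _ _ := rfl
  map_zero' := rfl
  map_add' _ _ := rfl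
  map_mul' _ _ := rfl
  map_star' _ := rfl

/-- Compression as a linear map `C⋆ᵣ(G, λ) → C⋆ᵣ(H, λ_H)`. -/
def reducedCompression : ReducedCStarAlgebra lam →ₗ[ℂ] ReducedCStarAlgebra (restrictHaar H lam) where
  toFun b := ⟨compress hlam hH b.toOperator, compress_mem hlam hH b.2⟩
  map_add' a b := Subtype.ext (map_add (compress hlam hH) a.toOperator b.toOperator)
  map_smul' c a := Subtype.ext (map_smul (compress hlam hH) c a.toOperator)

/-- The conditional expectation `C⋆ᵣ(G, λ) → C⋆ᵣ(H, λ_H)`. -/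
def reducedExpectation : ReducedCStarAlgebra lam →CP ReducedCStarAlgebra (restrictHaar H lam) where
  toLinearMap := reducedCompression hlam hH
  map_cstarMatrix_nonneg' k M hM :=
    cstarMatrix_map_nonneg_of_compression (toOperatorHom lam) (toOperatorHom (restrictHaar H lam))
      Subtype.val_injective (adjoint (restrictRep hlam hH)) (reducedCompression hlam hH)
      (fun a => by rw [ContinuousLinearMap.adjoint_adjoint]; rfl) k M hM

theorem isConditionalExpectation_reducedExpectation :
    IsConditionalExpectation (reducedInclusion hlam hH) (reducedExpectation hlam hH) where
  contractive b := norm_compress_le hlam hH b.toOperator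
  bimodule a c b := Subtype.ext <| by
    change compress hlam hH (liftOperator hlam hH a * b.toOperator * liftOperator hlam hH c) =
      a.toOperator * compress hlam hH b.toOperator * c.toOperator
    -- Multiplicativity needs only one factor in the extension algebra, so the outer factors split
    -- off while b is arbitrary.
    rw [compress_mul_of_mem_right hlam hH (liftOperator_mem hlam hH c),
      compress_mul_of_mem hlam hH (liftOperator_mem hlam hH a), compress_liftOperator,
      compress_liftOperator]
  apply_incl a := Subtype.ext (compress_liftOperator hlam hH a)

/-- The expectation is a left inverse of the inclusion. -/
theorem reducedInclusion_injective : Function.Injective (reducedInclusion hlam hH) :=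
  Function.LeftInverse.injective (g := reducedExpectation hlam hH)
    (isConditionalExpectation_reducedExpectation hlam hH).apply_incl

theorem exists_isImage_reducedInclusion {f : Arrows H.objs → ℂ} (hf : f ∈ Cc (Arrows H.objs)) :
    ∃ a : ReducedCStarAlgebra (restrictHaar H lam),
      a.IsImage f ∧ (reducedInclusion hlam hH a).IsImage (extendByZero H f) := by
  obtain ⟨T, hT⟩ := hlam.exists_isRegularOperator (extendByZero_mem_Cc hH hf)
  have hmem := hT.mem_extensionSubalgebra hf
  have h1 := hT.compression hlam hH
  rw [restrictFun_extendByZero] at h1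
  let a : ReducedCStarAlgebra (restrictHaar H lam) :=
    ⟨compress hlam hH T, compress_mem hlam hH (extensionSubalgebra_le hH hmem)⟩
  have h2 : liftOperator hlam hH a = T := liftOperator_eq hlam hH hmem rfl
  refine ⟨a, h1, ?_⟩
  change IsRegularOperator lam _ (liftOperator hlam hH a)
  rwa [h2]

theorem exists_isImage_reducedExpectation {f : Arrows C → ℂ} (hf : f ∈ Cc (Arrows C)) :
    ∃ b : ReducedCStarAlgebra lam,
      b.IsImage f ∧ (reducedExpectation hlam hH b).IsImage (restrictFun H f) := by
  obtain ⟨T, hT⟩ := hlam.exists_isRegularOperator hf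
  exact ⟨⟨T, mem_reducedSubalgebra_of_isRegularOperator hf hT⟩, hT, hT.compression hlam hH⟩

end Inclusion

end

theorem mainTheorem4 {C : Type u} [Groupoid.{v} C] [TopologicalSpace (Arrows C)]
    [IsLocallyCompactGroupoid C] (lam : ∀ w : C, Measure (RangeFiber w))
    (hlam : IsHaarSystem lam) (H : Subgroupoid C) (hH : IsClopen (arrowSet H)) :
    ∃ ι : ReducedCStarAlgebra (restrictHaar H lam) →⋆ₙₐ[ℂ] ReducedCStarAlgebra lam,
      Function.Injective ι ∧
      (∀ f ∈ Cc (Arrows H.objs), extendByZero H f ∈ Cc (Arrows C) ∧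
        ∃ a : ReducedCStarAlgebra (restrictHaar H lam),
          a.IsImage f ∧ (ι a).IsImage (extendByZero H f)) ∧
      ∃ e : ReducedCStarAlgebra lam →CP ReducedCStarAlgebra (restrictHaar H lam),
        IsConditionalExpectation ι e ∧
        ∀ f ∈ Cc (Arrows C), restrictFun H f ∈ Cc (Arrows H.objs) ∧
          ∃ b : ReducedCStarAlgebra lam, b.IsImage f ∧ (e b).IsImage (restrictFun H f) := by
  refine ⟨reducedInclusion hlam hH, reducedInclusion_injective hlam hH, fun f hf =>
    ⟨extendByZero_mem_Cc hH hf, exists_isImage_reducedInclusion hlam hH hf⟩,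
    reducedExpectation hlam hH, isConditionalExpectation_reducedExpectation hlam hH, fun f hf =>
    ⟨restrictFun_mem_Cc hH hf, exists_isImage_reducedExpectation hlam hH hf⟩⟩
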